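/- Consider a downlink with $N_t$ transmit antennas, a fixed receiver with $N_r$ antennas, layer powers $\rho_{ml}$ and $\rho_{fl}>0$, and a channel matrix $\mathbf H=[\mathbf h_1,\dots,\mathbf h_{N_t}]\in\mathbb C^{N_r\times N_t}$ with i.i.d. $\mathcal{CN}(0,1)$ entries. The transmitted symbol is $\sqrt{\rho_{ml}}\,\mathbf x_{ml}+\sqrt{\rho_{fl}}\,\mathbf x_{fl}$, where $\mathbf x_{ml}=s_{ml}\mathbf e_{a_{ml}}$ is the mobile-layer spatial modulation symbol and $\mathbf x_{fl}=s\,\mathbf e_a$ is the fixed-layer one, with $s\sim\mathcal{CN}(0,1)$, active antenna $a$ uniform on $\{1,\dots,N_t\}$, and $\mathbf e_m$ the $m$-th column of $\mathbf I_{N_t}$. The received symbol is $\mathbf y=\mathbf H(\sqrt{\rho_{ml}}\,\mathbf x_{ml}+\sqrt{\rho_{fl}}\,\mathbf x_{fl})+\mathbf n$ with $\mathbf n\sim\mathcal{CN}(\mathbf 0,\sigma^2\mathbf I)$, $\sigma^2>0$. After perfect cancellation of the mobile layer it becomes $\mathbf y_{fl}=\sqrt{\rho_{fl}}\,\mathbf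 H\mathbf x_{fl}+\mathbf n$. Let $\mathbf g_m$ ($1\le m\le N_t$) be random combining vectors; $(\mathbf H,\mathbf g_1,\dots,\mathbf g_{N_t})$, $s$, $a$ and $\mathbf n$ are mutually independent, $\mathbf g_m$ and $\mathbf g_m^H\mathbf h_{m'}$ are square integrable for all $m,m'$, and $E\{\mathbf g_m^H\mathbf h_m\}\ne 0$ for all $m$. Put $$\mathrm{SINR}_m=\frac{\frac{\rho_{fl}}{N_t}\left|E\{\mathbf g_m^H\mathbf h_m\}\right|^2}{\sum_{m'=1}^{N_t}\frac{\rho_{fl}}{N_t}E\{|\mathbf g_m^H\mathbf h_{m'}|^2\}-\frac{\rho_{fl}}{N_t}\left|E\{\mathbf g_m^H\mathbf h_m\}\right|^2+\sigma^2E\{\|\mathbf g_m\|^2\}} .$$ Then $\mathrm{SINR}_m>0$, and $\mathrm{SINR}_m$ is the ratio of the mean power of the useful part $u_m=\sqrt{\rho_{fl}}\,E\{\mathbf g_m^H\mathbf h_m\}\,(\mathbf x_{fl})_m$ of $\mathbf g_m^H\mathbf y_{fl}$ to the mean power of the remainder $\mathbf g_m^H\mathbf y_{fl}-u_m$; so only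 fixed-layer symbols and noise interfere. The spectral efficiency of the fixed layer with linear combining is the mutual information $I(\hat{\mathbf y};\mathbf x_{fl})$, in bits, of the equivalent additive-noise channel $\hat{\mathbf y}=\sqrt{N_t}\,\mathbf x_{fl}+\mathbf w$, whose input has mean power one per antenna and whose noise $\mathbf w\sim\mathcal{CN}\big(\mathbf 0,\mathrm{diag}\{1/\mathrm{SINR}_1,\dots,1/\mathrm{SINR}_{N_t}\}\big)$ is independent of $(s,a)$. With $$\mathbf\Sigma_m=\mathrm{diag}\Big\{\frac1{\mathrm{SINR}_1},\dots,\frac1{\mathrm{SINR}_{N_t}}\Big\}+N_t\,\mathrm{diag}\{\mathbf e_m\},$$ it is finite and satisfies $$I(\hat{\mathbf y};\mathbf x_{fl})\ \ge\ \log_2N_t-N_t+\frac1{N_t}\left\{\sum_{m=1}^{N_t}\log_2\left(1+N_t\,\mathrm{SINR}_m\right)-\sum_{m=1}^{N_t}\log_2\left[\sum_{m'=1}^{N_t}\frac{\det\mathbf\Sigma_m}{\det(\mathbf\Sigma_m+\mathbf\Sigma_{m'})}\right]\right\}.$$ -/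

import Mathlib

open MeasureTheory ProbabilityTheory InformationTheory
open scoped ENNReal NNReal Matrix

noncomputable section

namespace SMLDM

variable {Ω : Type*} [MeasurableSpace Ω] {Nt Nr : ℕ}

/-- The circularly symmetric complex Gaussian law `CN(0, v)` on `ℂ`: the real and the imaginary
part are independent real Gaussians with mean `0` and variance `v / 2`. -/
def complexGaussian (v : ℝ≥0) : Measure ℂ :=
  ((gaussianReal 0 (v / 2)).prod (gaussianReal 0 (v / 2))).map (fun p => (⟨p.1, p.2⟩ : ℂ))

/-- The random vector with components `X i` has law `CN(0, diag v)`: its components are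
independent, and the `i`-th one has law `CN(0, v i)` (with `0 ≤ v i`). -/
def IsDiagComplexGaussian {ι : Type*} (P : Measure Ω) (X : ι → Ω → ℂ) (v : ι → ℝ) : Prop :=
  (∀ i, HasLaw (X i) (complexGaussian (v i).toNNReal) P) ∧ iIndepFun X P

/-- The spatial modulation symbol `s • e_k`: the constellation symbol `s` is sent from the active
antenna `k`, all other antennas are silent. -/
def smSymbol (s : ℂ) (k : Fin Nt) : Fin Nt → ℂ := Pi.single k s

/-- The two-layer transmitted symbol `√ρml • xml + √ρfl • xfl`. -/
def transmitted (ρml ρfl : ℝ) (xml xfl : Fin Nt → ℂ) : Fin Nt → ℂ :=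
  (√ρml : ℂ) • xml + (√ρfl : ℂ) • xfl

/-- The received symbol `H x + n`. -/
def received (H : Matrix (Fin Nr) (Fin Nt) ℂ) (x : Fin Nt → ℂ) (n : Fin Nr → ℂ) : Fin Nr → ℂ :=
  H *ᵥ x + n

/-- Perfect cancellation of the mobile layer: its whole contribution is subtracted from the
received symbol. -/
def cancelML (H : Matrix (Fin Nr) (Fin Nt) ℂ) (ρml : ℝ) (xml : Fin Nt → ℂ) (y : Fin Nr → ℂ) :
    Fin Nr → ℂ :=
  y - (√ρml : ℂ) • (H *ᵥ xml)

/-- The linear combiner `gᴴ y`. -/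
def combine (g y : Fin Nr → ℂ) : ℂ := star g ⬝ᵥ y

/-- `E{gₘᴴ h_m'}`, where `h_m'` is the `m'`-th column of the channel matrix. -/
def meanGain (P : Measure Ω) (H : Ω → Matrix (Fin Nr) (Fin Nt) ℂ)
    (g : Fin Nt → Ω → Fin Nr → ℂ) (m m' : Fin Nt) : ℂ :=
  ∫ ω, combine (g m ω) (fun i => H ω i m') ∂P

/-- `E{|gₘᴴ h_m'|²}`. -/
def powerGain (P : Measure Ω) (H : Ω → Matrix (Fin Nr) (Fin Nt) ℂ)
    (g : Fin Nt → Ω → Fin Nr → ℂ) (m m' : Fin Nt) : ℝ :=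
  ∫ ω, ‖combine (g m ω) (fun i => H ω i m')‖ ^ 2 ∂P

/-- The fixed-layer SINR of the `m`-th antenna under linear combining; `σ2` is the noise
variance. -/
def sinrFL (P : Measure Ω) (ρfl σ2 : ℝ) (H : Ω → Matrix (Fin Nr) (Fin Nt) ℂ)
    (g : Fin Nt → Ω → Fin Nr → ℂ) (m : Fin Nt) : ℝ :=
  (ρfl / Nt * ‖meanGain P H g m m‖ ^ 2) /
    ((∑ m' : Fin Nt, ρfl / Nt * powerGain P H g m m')
      - ρfl / Nt * ‖meanGain P H g m m‖ ^ 2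
      + σ2 * ∫ ω, ∑ i, ‖g m ω i‖ ^ 2 ∂P)

/-- The ratio of the mean power of the useful part `u` of a scalar signal `z` to the mean power
of the remainder `z - u`. -/
def powerRatio (P : Measure Ω) (z u : Ω → ℂ) : ℝ :=
  (∫ ω, ‖u ω‖ ^ 2 ∂P) / (∫ ω, ‖z ω - u ω‖ ^ 2 ∂P)

/-- `Σₘ = diag(1 / SINR₁, …, 1 / SINR_Nt) + Nt diag(eₘ)`. -/
def sigmaFL (sinr : Fin Nt → ℝ) (m : Fin Nt) : Matrix (Fin Nt) (Fin Nt) ℝ :=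
  Matrix.diagonal (fun i => 1 / sinr i) + (Nt : ℝ) • Matrix.diagonal (Pi.single m 1)

/-- The lower bound on the spectral efficiency of the fixed layer, in bits. -/
def seBoundFL (sinr : Fin Nt → ℝ) : ℝ :=
  Real.logb 2 Nt - Nt + 1 / Nt *
    ((∑ m, Real.logb 2 (1 + Nt * sinr m))
      - ∑ m, Real.logb 2
          (∑ m', (sigmaFL sinr m).det / (sigmaFL sinr m + sigmaFL sinr m').det))

/-- Mutual information `I(X; Y)` in nats: the Kullback-Leibler divergence of the joint law from
the product of the marginal laws. -/
def mutualInfo {A B : Type*} [MeasurableSpace A] [MeasurableSpace B] (P : Measure Ω)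
    (X : Ω → A) (Y : Ω → B) : ℝ≥0∞ :=
  klDiv (P.map (fun ω => (X ω, Y ω))) ((P.map X).prod (P.map Y))

end SMLDM

end

namespace SMLDM

/-! Take the noise law `CN(0, diag v)` of the equivalent channel, with v_m = 1 / SINR_m, as
reference measure. Given the input x, the output has density L = `vecShiftRatio`. Averaging over x
gives the output density f = `mixRatio`, the mean of N densities r_m: if antenna m is active, the
Gaussian symbol only multiplies the m-th variance by 1 + t_m, where t_m = Nt SINR_m. Hence, in nats,
I = E log L - ∫ f log f (`mutualInfo_channel`). The first term is N⁻¹ ∑ t_m, since input and noise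
are uncorrelated. What is left is an upper bound for ∫ f log f, which has no closed form.

That bound (`mixture_mul_log_le`, `integral_mixRatio_mul_log_le`) uses mismatched decoding of the
active antenna. By Gibbs' inequality the true posterior r_m / ∑ r may be replaced by ψ_m / ∑ ψ for
any positive metrics ψ. The remaining logarithm is bounded by a tangent line, as in Jensen's
inequality, with contact point the explicit Gaussian integral c_m. Halving the exponent of r_m to
form ψ_m makes these integrals averages of `overlap`, which is exactly 2 ^ N det Σ_m / det (Σ_m +
Σ_m') (`det_sigmaFL_div`). The factor 2 ^ N is the term -N of the bound in bits; Jensen's inequality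
applied directly to the Lebesgue density of the output would give the weaker -N log₂ e.

For the SINR, the combiner output minus its useful part is a sum of uncorrelated signals (antenna
symbols and noise components) with coefficients independent of them, so the powers add up
(`integral_norm_sq_sum_mul`). -/

/-! ### The scalar law `CN(0, v)`: density, tilts, shifts and moments. -/

lemma complexGaussian_eq_map (v : ℝ≥0) :
    complexGaussian v = ((gaussianReal 0 (v / 2)).prod (gaussianReal 0 (v / 2))).map
      Complex.measurableEquivRealProd.symm := rfl

instance (v : ℝ≥0) : IsProbabilityMeasure (complexGaussian v) := by
  rw [complexGaussian_eq_map]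
  exact Measure.isProbabilityMeasure_map (MeasurableEquiv.measurable _).aemeasurable

/-- The density of `CN(0, v)`. -/
noncomputable def complexGaussianPDF (v : ℝ) (z : ℂ) : ℝ :=
  1 / (Real.pi * v) * Real.exp (-(‖z‖ ^ 2 / v))

@[fun_prop]
lemma measurable_complexGaussianPDF (v : ℝ) : Measurable (complexGaussianPDF v) := by
  unfold complexGaussianPDF; fun_prop

lemma complexGaussianPDF_nonneg {v : ℝ} (hv : 0 ≤ v) (z : ℂ) : 0 ≤ complexGaussianPDF v z := by
  unfold complexGaussianPDF; positivity

lemma complexGaussian_eq_withDensity {v : ℝ} (hv : 0 < v) :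
    complexGaussian v.toNNReal
      = volume.withDensity (fun z => ENNReal.ofReal (complexGaussianPDF v z)) := by
  have hv2 : v.toNNReal / 2 ≠ 0 := by
    have : v.toNNReal ≠ 0 := by simpa using hv
    positivity
  rw [complexGaussian_eq_map, gaussianReal_of_var_ne_zero _ hv2,
    prod_withDensity (by fun_prop) (by fun_prop), ← Measure.volume_eq_prod]
  refine Measure.ext_of_lintegral _ fun F hF => ?_
  rw [lintegral_map hF (MeasurableEquiv.measurable _),
    lintegral_withDensity_eq_lintegral_mul _ (by fun_prop)
      (g := fun p => F (Complex.measurableEquivRealProd.symm p))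
      (hF.comp (MeasurableEquiv.measurable _)),
    lintegral_withDensity_eq_lintegral_mul _ (by fun_prop) hF,
    ← (Complex.volume_preserving_equiv_real_prod.symm _).lintegral_comp (by fun_prop)]
  refine lintegral_congr fun p => ?_
  simp only [Pi.mul_apply]
  congr 1
  simp only [gaussianPDF]
  rw [← ENNReal.ofReal_mul (gaussianPDFReal_nonneg _ _ _)]
  congr 1
  have h2 : ((v.toNNReal / 2 : ℝ≥0) : ℝ) = v / 2 := by simp [hv.le]
  have h3 : ‖Complex.measurableEquivRealProd.symm p‖ ^ 2 = p.1 ^ 2 + p.2 ^ 2 := by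
    rw [← Complex.normSq_eq_norm_sq, Complex.measurableEquivRealProd_symm_apply,
      Complex.normSq_mk]; ring
  rw [complexGaussianPDF, h3, gaussianPDFReal_def, h2]
  have h4 : 2 * Real.pi * (v / 2) = Real.pi * v := by ring
  have h5 : 2 * (v / 2) = v := by ring
  simp only [h4, h5, sub_zero]
  rw [mul_mul_mul_comm, ← Real.exp_add, ← mul_inv, Real.mul_self_sqrt (by positivity)]
  rw [one_div]; congr 2; ring

lemma lintegral_complexGaussian {v : ℝ} (hv : 0 < v) {F : ℂ → ℝ≥0∞} (hF : Measurable F) :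
    ∫⁻ z, F z ∂complexGaussian v.toNNReal
      = ∫⁻ z, ENNReal.ofReal (complexGaussianPDF v z) * F z := by
  rw [complexGaussian_eq_withDensity hv,
    lintegral_withDensity_eq_lintegral_mul _ (by fun_prop) hF]; rfl

lemma lintegral_complexGaussianPDF {v : ℝ} (hv : 0 < v) :
    ∫⁻ z, ENNReal.ofReal (complexGaussianPDF v z) = 1 := by
  have := lintegral_complexGaussian hv (F := fun _ => 1) measurable_const
  simpa using this.symm

/-- Reweighting a centred complex Gaussian law by `exp (b ‖z‖²)` gives a multiple of another one. -/
lemma complexGaussian_withDensity_exp {v b : ℝ} (hv : 0 < v) (hb : b * v < 1) :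
    (complexGaussian v.toNNReal).withDensity (fun z => ENNReal.ofReal (Real.exp (b * ‖z‖ ^ 2)))
      = ENNReal.ofReal (1 - b * v)⁻¹ • complexGaussian (v / (1 - b * v)).toNNReal := by
  have h1 : 0 < 1 - b * v := by linarith
  rw [complexGaussian_eq_withDensity hv, complexGaussian_eq_withDensity (div_pos hv h1),
    ← withDensity_smul _ (by fun_prop), ← withDensity_mul _ (by fun_prop) (by fun_prop)]
  congr 1
  funext z
  simp only [Pi.mul_apply, Pi.smul_apply, smul_eq_mul]
  rw [← ENNReal.ofReal_mul (complexGaussianPDF_nonneg hv.le _),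
    ← ENNReal.ofReal_mul (inv_nonneg.2 h1.le)]
  congr 1
  unfold complexGaussianPDF
  rw [mul_assoc, ← Real.exp_add, ← mul_assoc]
  congr 2
  · generalize 1 - b * v = k at h1
    field_simp
  · field_simp; ring

/-- The likelihood ratio of `CN(c, v)` with respect to `CN(0, v)`. -/
noncomputable def shiftRatio (v : ℝ) (c z : ℂ) : ℝ :=
  Real.exp ((2 * (star c * z).re - ‖c‖ ^ 2) / v)

@[fun_prop]
lemma measurable_shiftRatio (v : ℝ) (c : ℂ) : Measurable (shiftRatio v c) := by
  unfold shiftRatio; fun_prop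

lemma shiftRatio_pos (v : ℝ) (c z : ℂ) : 0 < shiftRatio v c z := Real.exp_pos _

lemma norm_sub_sq_complex (z c : ℂ) :
    ‖z - c‖ ^ 2 = ‖z‖ ^ 2 - (2 * (star c * z).re - ‖c‖ ^ 2) := by
  simp only [← Complex.normSq_eq_norm_sq, Complex.normSq_apply, Complex.sub_re, Complex.sub_im,
    Complex.mul_re, Complex.star_def, Complex.conj_re, Complex.conj_im]
  ring

lemma complexGaussianPDF_sub (v : ℝ) (c z : ℂ) :
    complexGaussianPDF v (z - c) = complexGaussianPDF v z * shiftRatio v c z := by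
  unfold complexGaussianPDF shiftRatio
  rw [norm_sub_sq_complex, mul_assoc, ← Real.exp_add]
  congr 2; ring

/-- Lebesgue measure is translation invariant, so shifting the law shifts its density, and
`complexGaussianPDF_sub` identifies the quotient of the two densities. -/
lemma complexGaussian_map_add_const {v : ℝ} (hv : 0 < v) (c : ℂ) :
    (complexGaussian v.toNNReal).map (fun z => z + c)
      = (complexGaussian v.toNNReal).withDensity (fun z => ENNReal.ofReal (shiftRatio v c z)) := by
  refine Measure.ext_of_lintegral _ fun F hF => ?_
  rw [lintegral_map hF (by fun_prop), lintegral_complexGaussian hv (by fun_prop),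
    lintegral_withDensity_eq_lintegral_mul _ (by fun_prop) hF,
    lintegral_complexGaussian hv (by fun_prop),
    ← lintegral_sub_right_eq_self _ c]
  refine lintegral_congr fun z => ?_
  simp only [Pi.mul_apply, sub_add_cancel]
  rw [complexGaussianPDF_sub, ENNReal.ofReal_mul (complexGaussianPDF_nonneg hv.le _), mul_assoc]

/-- The likelihood ratio of `CN(0, v + c ^ 2)` with respect to `CN(0, v)`, where `t = c ^ 2 / v`. -/
noncomputable def spreadRatio (v t : ℝ) (z : ℂ) : ℝ :=
  (1 + t)⁻¹ * Real.exp (t / (1 + t) / v * ‖z‖ ^ 2)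

@[fun_prop]
lemma measurable_spreadRatio (v t : ℝ) : Measurable (spreadRatio v t) := by
  unfold spreadRatio; fun_prop

lemma spreadRatio_pos {v t : ℝ} (ht : 0 < t) (z : ℂ) : 0 < spreadRatio v t z := by
  unfold spreadRatio; positivity

/-- Averaging `CN(c s, v)` over `s ∼ CN(0, 1)`. -/
lemma lintegral_shiftRatio {v c : ℝ} (hv : 0 < v) (z : ℂ) :
    ∫⁻ s, ENNReal.ofReal (shiftRatio v ((c : ℂ) * s) z) ∂complexGaussian 1
      = ENNReal.ofReal (spreadRatio v (c ^ 2 / v) z) := by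
  have h1 : (0 : ℝ) < 1 := one_pos
  set t := c ^ 2 / v with ht
  have ht0 : 0 ≤ t := by positivity
  have ht1 : 0 < 1 + t := by positivity
  -- Bayes' rule by completing the square: `d` and `1 / (1 + t)` are the posterior mean and variance
  -- of `s` given the observation `z` of `c s` in noise of variance `v`. In `key`, prior times
  -- likelihood equals evidence times posterior, and the posterior integrates to 1.
  set d : ℂ := ((c / v / (1 + t) : ℝ) : ℂ) * z with hd
  have key : ∀ s : ℂ, complexGaussianPDF 1 s * shiftRatio v ((c : ℂ) * s) z
      = spreadRatio v t z * complexGaussianPDF (1 / (1 + t)) (s - d) := by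
    intro s
    unfold complexGaussianPDF shiftRatio spreadRatio
    rw [mul_assoc, ← Real.exp_add, mul_mul_mul_comm, ← Real.exp_add]
    congr 1
    · field_simp
    · congr 1
      rw [norm_sub_sq_complex]
      have e1 : ‖(c : ℂ) * s‖ ^ 2 = c ^ 2 * ‖s‖ ^ 2 := by
        rw [norm_mul, mul_pow, Complex.norm_real, Real.norm_eq_abs, sq_abs]
      have e2 : ‖d‖ ^ 2 = (c / v / (1 + t)) ^ 2 * ‖z‖ ^ 2 := by
        rw [hd, norm_mul, mul_pow, Complex.norm_real, Real.norm_eq_abs, sq_abs]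
      have e3 : (star ((c : ℂ) * s) * z).re = c * (s.re * z.re + s.im * z.im) := by
        simp [Complex.mul_re, Complex.mul_im]; ring
      have e4 : (star d * s).re = (c / v / (1 + t)) * (s.re * z.re + s.im * z.im) := by
        rw [hd]
        generalize c / v / (1 + t) = k
        simp [Complex.mul_re, Complex.mul_im]; ring
      rw [e1, e2, e3, e4]
      have e5 : c ^ 2 = t * v := by rw [ht]; field_simp
      have e6 : (c / v / (1 + t)) ^ 2 = t / v / (1 + t) ^ 2 := by
        rw [div_pow, div_pow, e5]; field_simp
      rw [e5, e6]
      field_simp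
      ring
  have hm : Measurable fun s => ENNReal.ofReal (shiftRatio v ((c : ℂ) * s) z) := by
    unfold shiftRatio; fun_prop
  have := lintegral_complexGaussian h1 hm
  rw [Real.toNNReal_one] at this
  rw [this]
  simp_rw [← ENNReal.ofReal_mul (complexGaussianPDF_nonneg h1.le _), key]
  have hs : 0 ≤ spreadRatio v t z := by unfold spreadRatio; positivity
  simp_rw [ENNReal.ofReal_mul hs]
  rw [lintegral_const_mul _ (by fun_prop), lintegral_sub_right_eq_self
    (fun s => ENNReal.ofReal (complexGaussianPDF (1 / (1 + t)) s)) d,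
    lintegral_complexGaussianPDF (by positivity), mul_one]

lemma integral_complexGaussian_eq_integral_prod {v : ℝ≥0} {E : Type*} [NormedAddCommGroup E]
    [NormedSpace ℝ E] (F : ℂ → E) :
    ∫ z, F z ∂complexGaussian v
      = ∫ p, F ⟨p.1, p.2⟩ ∂(gaussianReal 0 (v / 2)).prod (gaussianReal 0 (v / 2)) := by
  rw [complexGaussian_eq_map, integral_map_equiv]; rfl

lemma integrable_complexGaussian_iff {v : ℝ≥0} {E : Type*} [NormedAddCommGroup E]
    {F : ℂ → E} :
    Integrable F (complexGaussian v) ↔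
      Integrable (fun p : ℝ × ℝ => F ⟨p.1, p.2⟩)
        ((gaussianReal 0 (v / 2)).prod (gaussianReal 0 (v / 2))) := by
  rw [complexGaussian_eq_map, integrable_map_equiv]; rfl

lemma memLp_id_complexGaussian (v : ℝ≥0) : MemLp (fun z : ℂ => z) 2 (complexGaussian v) := by
  rw [memLp_two_iff_integrable_sq_norm (by fun_prop), integrable_complexGaussian_iff]
  have h : ∀ p : ℝ × ℝ, ‖(⟨p.1, p.2⟩ : ℂ)‖ ^ 2 = p.1 ^ 2 + p.2 ^ 2 := fun p => by
    rw [← Complex.normSq_eq_norm_sq, Complex.normSq_mk]; ring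
  simp_rw [h]
  have hg : Integrable (fun x : ℝ => x ^ 2) (gaussianReal 0 (v / 2)) :=
    (memLp_id_gaussianReal 2).integrable_sq
  exact (hg.comp_fst _).add (hg.comp_snd _)

lemma integral_sq_gaussianReal (v : ℝ≥0) : ∫ x, x ^ 2 ∂gaussianReal 0 v = v := by
  have h := variance_fun_id_gaussianReal (μ := 0) (v := v)
  rw [variance_of_integral_eq_zero (by fun_prop) (by simp)] at h
  exact h

lemma integral_norm_sq_complexGaussian (v : ℝ≥0) : ∫ z, ‖z‖ ^ 2 ∂complexGaussian v = v := by
  have h : ∀ p : ℝ × ℝ, ‖(⟨p.1, p.2⟩ : ℂ)‖ ^ 2 = p.1 ^ 2 + p.2 ^ 2 := fun p => by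
    rw [← Complex.normSq_eq_norm_sq, Complex.normSq_mk]; ring
  have hg : Integrable (fun x : ℝ => x ^ 2) (gaussianReal 0 (v / 2)) :=
    (memLp_id_gaussianReal 2).integrable_sq
  rw [integral_complexGaussian_eq_integral_prod]
  simp_rw [h]
  rw [integral_add (hg.comp_fst _) (hg.comp_snd _), integral_fun_fst (fun x : ℝ => x ^ 2),
    integral_fun_snd (fun x : ℝ => x ^ 2), integral_sq_gaussianReal]
  simp

lemma integral_id_complexGaussian (v : ℝ≥0) : ∫ z, z ∂complexGaussian v = 0 := by
  have hi : Integrable (fun z : ℂ => z) (complexGaussian v) :=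
    (memLp_id_complexGaussian v).integrable one_le_two
  have hre := integral_complexGaussian_eq_integral_prod (v := v) (fun z => z.re)
  have him := integral_complexGaussian_eq_integral_prod (v := v) (fun z => z.im)
  simp only at hre him
  rw [integral_fun_fst (fun x : ℝ => x)] at hre
  rw [integral_fun_snd (fun x : ℝ => x)] at him
  simp only [integral_id_gaussianReal, smul_zero] at hre him
  apply Complex.ext
  · have := integral_re hi
    simp only [Complex.zero_re]
    exact this.symm.trans hre
  · have := integral_im hi
    simp only [Complex.zero_im]
    exact this.symm.trans him

/-! ### Densities on `ℂ ^ N` relative to `CN(0, diag v)`. -/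

section

lemma lintegral_pi_prod_eq_prod {ι α : Type*} [Fintype ι] [MeasurableSpace α] (μ : ι → Measure α)
    [∀ i, IsProbabilityMeasure (μ i)] {f : ι → α → ℝ≥0∞} (hf : ∀ i, Measurable (f i)) :
    ∫⁻ x, ∏ i, f i (x i) ∂Measure.pi μ = ∏ i, ∫⁻ x, f i x ∂μ i := by
  have hind : iIndepFun (fun i (x : ι → α) => f i (x i)) (Measure.pi μ) :=
    iIndepFun_pi (fun i => (hf i).aemeasurable)
  have h := lintegral_prod_eq_prod_lintegral_of_indepFun Finset.univ _ hind
    (fun i => (hf i).comp (measurable_pi_apply i))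
  rw [h]
  refine Finset.prod_congr rfl fun i _ => ?_
  exact (measurePreserving_eval μ i).lintegral_comp (hf i)

/-- Boxes determine a product measure, and on a box the indicator times the product density is again
a product of one-variable functions. -/
lemma pi_withDensity {ι α : Type*} [Fintype ι] [MeasurableSpace α] (μ : ι → Measure α)
    [∀ i, IsProbabilityMeasure (μ i)] {f : ι → α → ℝ≥0∞} (hf : ∀ i, Measurable (f i))
    [∀ i, SigmaFinite ((μ i).withDensity (f i))] :
    Measure.pi (fun i => (μ i).withDensity (f i))
      = (Measure.pi μ).withDensity (fun x => ∏ i, f i (x i)) := by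
  refine Measure.pi_eq fun s hs => ?_
  rw [withDensity_apply _ (MeasurableSet.univ_pi hs),
    ← lintegral_indicator (MeasurableSet.univ_pi hs)]
  have h : ∀ x : ι → α, (Set.univ.pi s).indicator (fun x => ∏ i, f i (x i)) x
      = ∏ i, (s i).indicator (f i) (x i) := by
    intro x
    classical
    by_cases hx : x ∈ Set.univ.pi s
    · rw [Set.indicator_of_mem hx]
      exact Finset.prod_congr rfl fun i _ =>
        (Set.indicator_of_mem (hx i (Set.mem_univ i)) _).symm
    · rw [Set.indicator_of_notMem hx]
      simp only [Set.mem_univ_pi, not_forall] at hx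
      obtain ⟨i, hi⟩ := hx
      exact (Finset.prod_eq_zero (Finset.mem_univ i) (Set.indicator_of_notMem hi _)).symm
  simp_rw [h]
  rw [lintegral_pi_prod_eq_prod μ fun i => (hf i).indicator (hs i)]
  refine Finset.prod_congr rfl fun i _ => ?_
  rw [lintegral_indicator (hs i), withDensity_apply _ (hs i)]

/-- The law `CN(0, diag v)` on `ℂ ^ N`. -/
noncomputable def diagGaussian {N : ℕ} (v : Fin N → ℝ) : Measure (Fin N → ℂ) :=
  Measure.pi fun i => complexGaussian (v i).toNNReal

instance {N : ℕ} (v : Fin N → ℝ) : IsProbabilityMeasure (diagGaussian v) := by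
  unfold diagGaussian; infer_instance

variable {N : ℕ} {v : Fin N → ℝ}

/-- The likelihood ratio of `CN(x, diag v)` with respect to `CN(0, diag v)` at `y`. -/
noncomputable def vecShiftRatio (v : Fin N → ℝ) (x y : Fin N → ℂ) : ℝ :=
  ∏ i, shiftRatio (v i) (x i) (y i)

lemma vecShiftRatio_pos (v : Fin N → ℝ) (x y : Fin N → ℂ) : 0 < vecShiftRatio v x y :=
  Finset.prod_pos fun _ _ => shiftRatio_pos _ _ _

lemma measurable_vecShiftRatio (v : Fin N → ℝ) (c : ℝ) :
    Measurable (fun p : (Fin N → ℂ) × (Fin N → ℂ) => vecShiftRatio v ((c : ℂ) • p.2) p.1) := by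
  unfold vecShiftRatio shiftRatio
  simp only [Pi.smul_apply]
  fun_prop

lemma measurable_vecShiftRatio_right (v : Fin N → ℝ) (x : Fin N → ℂ) :
    Measurable (vecShiftRatio v x) := by
  unfold vecShiftRatio
  fun_prop

lemma measurable_vecShiftRatio_left (v : Fin N → ℝ) (c : ℝ) (y : Fin N → ℂ) :
    Measurable (fun x : Fin N → ℂ => vecShiftRatio v ((c : ℂ) • x) y) := by
  unfold vecShiftRatio shiftRatio
  simp only [Pi.smul_apply]
  fun_prop

lemma diagGaussian_map_add_const (hv : ∀ i, 0 < v i) (x : Fin N → ℂ) :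
    (diagGaussian v).map (fun z => x + z)
      = (diagGaussian v).withDensity (fun y => ENNReal.ofReal (vecShiftRatio v x y)) := by
  have h : ∀ i, (complexGaussian (v i).toNNReal).withDensity
      (fun z => ENNReal.ofReal (shiftRatio (v i) (x i) z))
        = (complexGaussian (v i).toNNReal).map (fun z => z + x i) :=
    fun i => (complexGaussian_map_add_const (hv i) (x i)).symm
  have : ∀ i, IsProbabilityMeasure ((complexGaussian (v i).toNNReal).map (fun z => z + x i)) :=
    fun i => Measure.isProbabilityMeasure_map (by fun_prop)
  have : ∀ i, SigmaFinite ((complexGaussian (v i).toNNReal).withDensity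
      (fun z => ENNReal.ofReal (shiftRatio (v i) (x i) z))) := fun i => by
    rw [h i]; infer_instance
  have h2 := pi_withDensity (fun i => complexGaussian (v i).toNNReal)
    (f := fun i z => ENNReal.ofReal (shiftRatio (v i) (x i) z)) (fun i => by fun_prop)
  unfold diagGaussian vecShiftRatio
  simp_rw [ENNReal.ofReal_prod_of_nonneg fun i _ => (shiftRatio_pos (v i) (x i) _).le]
  rw [← h2]
  simp_rw [h]
  rw [← Measure.pi_map_pi (fun i => by fun_prop)]
  congr 1
  funext z i
  exact add_comm _ _

/-- The joint law of output and input of an additive Gaussian noise channel. -/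
lemma map_channel_eq_withDensity (hv : ∀ i, 0 < v i) (μ : Measure (Fin N → ℂ)) [SFinite μ]
    (c : ℝ) :
    ((diagGaussian v).prod μ).map (fun p => ((c : ℂ) • p.2 + p.1, p.2))
      = ((diagGaussian v).prod μ).withDensity
          (fun p => ENNReal.ofReal (vecShiftRatio v ((c : ℂ) • p.2) p.1)) := by
  have hL := (measurable_vecShiftRatio v c).ennreal_ofReal
  have hm : Measurable fun p : (Fin N → ℂ) × (Fin N → ℂ) => ((c : ℂ) • p.2 + p.1, p.2) := by
    fun_prop
  refine Measure.ext_of_lintegral _ fun F hF => ?_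
  rw [lintegral_map hF hm, lintegral_withDensity_eq_lintegral_mul _ hL hF,
    lintegral_prod_symm (fun p => F ((c : ℂ) • p.2 + p.1, p.2)) (hF.comp hm).aemeasurable, lintegral_prod_symm _ (hL.mul hF).aemeasurable]
  -- For a fixed input the output is a translate of the noise.
  refine lintegral_congr fun x => ?_
  have hFx : Measurable fun y => F (y, x) := hF.comp (by fun_prop)
  have hLx : Measurable fun y => ENNReal.ofReal (vecShiftRatio v ((c : ℂ) • x) y) :=
    (measurable_vecShiftRatio_right v _).ennreal_ofReal
  have h1 := lintegral_map (μ := diagGaussian v) hFx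
    (g := fun z => (c : ℂ) • x + z) (by fun_prop)
  rw [diagGaussian_map_add_const hv, lintegral_withDensity_eq_lintegral_mul _ hLx hFx] at h1
  simp only [Pi.mul_apply] at h1 ⊢
  exact h1.symm

lemma measurable_smSymbol : Measurable fun p : ℂ × Fin N => smSymbol p.1 p.2 := by
  refine measurable_from_prod_countable_left fun m => ?_
  unfold smSymbol
  refine measurable_pi_lambda _ fun i => ?_
  by_cases h : i = m
  · subst h; simpa using measurable_id'
  · simp [Pi.single_eq_of_ne h]

/-- The law of an input `s • e_a` with Gaussian `s` and uniform `a`. -/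
lemma lintegral_smSymbol {Ω : Type*} [MeasurableSpace Ω] {P : Measure Ω} [IsProbabilityMeasure P]
    {s : Ω → ℂ} (hs : HasLaw s (complexGaussian 1) P) {a : Ω → Fin N} (ha : Measurable a)
    (ha_unif : ∀ m, P (a ⁻¹' {m}) = (N : ℝ≥0∞)⁻¹) (hind : IndepFun s a P)
    {F : (Fin N → ℂ) → ℝ≥0∞} (hF : Measurable F) :
    ∫⁻ ω, F (smSymbol (s ω) (a ω)) ∂P
      = ∑ m, (N : ℝ≥0∞)⁻¹ * ∫⁻ z, F (smSymbol z m) ∂complexGaussian 1 := by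
  have hm : Measurable fun p : ℂ × Fin N => F (smSymbol p.1 p.2) := hF.comp measurable_smSymbol
  have h1 : P.map (fun ω => (s ω, a ω)) = (complexGaussian 1).prod (P.map a) := by
    rw [(indepFun_iff_map_prod_eq_prod_map_map hs.aemeasurable ha.aemeasurable).1 hind, hs.map_eq]
  have : IsProbabilityMeasure (P.map a) := Measure.isProbabilityMeasure_map ha.aemeasurable
  rw [← lintegral_map' (f := fun p : ℂ × Fin N => F (smSymbol p.1 p.2)) (g := fun ω => (s ω, a ω))
    hm.aemeasurable (hs.aemeasurable.prodMk ha.aemeasurable), h1,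
    lintegral_prod_symm _ hm.aemeasurable, lintegral_fintype]
  refine Finset.sum_congr rfl fun m _ => ?_
  rw [Measure.map_apply ha (measurableSet_singleton m), ha_unif, mul_comm]

/-- A silent antenna shifts its coordinate by 0 and contributes the factor 1. -/
lemma vecShiftRatio_smSymbol (c : ℝ) (z : ℂ) (m : Fin N) (y : Fin N → ℂ) :
    vecShiftRatio v ((c : ℂ) • smSymbol z m) y = shiftRatio (v m) (c * z) (y m) := by
  unfold vecShiftRatio smSymbol
  rw [Finset.prod_eq_single m]
  · simp
  · intro i _ hi
    simp [Pi.single_eq_of_ne hi, shiftRatio]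
  · simp

/-- The density, relative to `CN(0, diag v)`, of the equal mixture over `m` of Gaussian laws whose
`m`-th variance is increased by the factor `1 + t m`. -/
noncomputable def mixRatio (v t : Fin N → ℝ) (y : Fin N → ℂ) : ℝ :=
  (N : ℝ)⁻¹ * ∑ m, spreadRatio (v m) (t m) (y m)

@[fun_prop]
lemma measurable_mixRatio (v t : Fin N → ℝ) : Measurable (mixRatio v t) := by
  unfold mixRatio; fun_prop

lemma mixRatio_pos [NeZero N] {t : Fin N → ℝ} (ht : ∀ i, 0 < t i) (y : Fin N → ℂ) :
    0 < mixRatio v t y := by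
  have hN : 0 < (N : ℝ) := Nat.cast_pos.2 (NeZero.pos N)
  exact mul_pos (inv_pos.2 hN)
    (Finset.sum_pos (fun m _ => spreadRatio_pos (ht m) _) Finset.univ_nonempty)

/-- Relative densities of two measures give their log-likelihood ratio. -/
lemma llr_withDensity_ofReal {α : Type*} [MeasurableSpace α] {μ : Measure α} [SigmaFinite μ]
    {p q : α → ℝ} (hp : Measurable p) (hq : Measurable q) (hp0 : ∀ x, 0 < p x)
    (hq0 : ∀ x, 0 < q x) :
    (μ.withDensity fun x => ENNReal.ofReal (p x)) ≪ (μ.withDensity fun x => ENNReal.ofReal (q x)) ∧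
    llr (μ.withDensity fun x => ENNReal.ofReal (p x)) (μ.withDensity fun x => ENNReal.ofReal (q x))
      =ᵐ[μ.withDensity fun x => ENNReal.ofReal (p x)] fun x => Real.log (p x) - Real.log (q x) := by
  set Q := μ.withDensity fun x => ENNReal.ofReal (q x) with hQ
  have : SigmaFinite Q := SigmaFinite.withDensity_of_ne_top (by simp)
  -- Changing the reference measure from `μ` to `Q` exhibits the Radon-Nikodym derivative as `p /
  -- q`; positivity of `q` makes this legitimate everywhere.
  have h : (μ.withDensity fun x => ENNReal.ofReal (p x))
      = Q.withDensity fun x => ENNReal.ofReal (p x / q x) := by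
    rw [hQ, ← withDensity_mul _ (by fun_prop) (by fun_prop)]
    congr 1
    funext x
    rw [Pi.mul_apply, ← ENNReal.ofReal_mul (hq0 x).le, mul_div_cancel₀ _ (hq0 x).ne']
  rw [h]
  refine ⟨withDensity_absolutelyContinuous _ _, ?_⟩
  have hr := Measure.rnDeriv_withDensity Q
    (f := fun x => ENNReal.ofReal (p x / q x)) (by fun_prop)
  filter_upwards [(withDensity_absolutelyContinuous Q _).ae_le hr] with x hx
  rw [llr, hx, ENNReal.toReal_ofReal (div_pos (hp0 x) (hq0 x)).le,
    Real.log_div (hp0 x).ne' (hq0 x).ne']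

end

/-! ### Relative entropy of the Gaussian mixture: the mismatched-decoding bound. -/

section

/-- The exponential weight is absorbed into the variance by `complexGaussian_withDensity_exp`, up to
a positive finite factor. All Gaussian integrals below reduce to this and to `integral_exp_mul`. -/
lemma integrable_exp_mul_iff {v b : ℝ} (hv : 0 < v) (hb : b * v < 1) {F : ℂ → ℝ} :
    Integrable (fun z => Real.exp (b * ‖z‖ ^ 2) * F z) (complexGaussian v.toNNReal) ↔
      Integrable F (complexGaussian (v / (1 - b * v)).toNNReal) := by
  have h1 : 0 < 1 - b * v := by linarith
  have h := integrable_withDensity_iff_integrable_smul' (μ := complexGaussian v.toNNReal)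
    (f := fun z => ENNReal.ofReal (Real.exp (b * ‖z‖ ^ 2))) (g := F) (by fun_prop) (by simp)
  rw [complexGaussian_withDensity_exp hv hb,
    integrable_smul_measure (by simpa using h1) ENNReal.ofReal_ne_top] at h
  rw [h]
  simp only [ENNReal.toReal_ofReal (Real.exp_pos _).le, smul_eq_mul]

lemma integral_exp_mul {v b : ℝ} (hv : 0 < v) (hb : b * v < 1) (F : ℂ → ℝ) :
    ∫ z, Real.exp (b * ‖z‖ ^ 2) * F z ∂complexGaussian v.toNNReal
      = (1 - b * v)⁻¹ * ∫ z, F z ∂complexGaussian (v / (1 - b * v)).toNNReal := by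
  have h1 : 0 < 1 - b * v := by linarith
  have h := integral_withDensity_eq_integral_toReal_smul (μ := complexGaussian v.toNNReal)
    (f := fun z => ENNReal.ofReal (Real.exp (b * ‖z‖ ^ 2))) (by fun_prop) (by simp) F
  rw [complexGaussian_withDensity_exp hv hb, integral_smul_measure,
    ENNReal.toReal_ofReal (inv_nonneg.2 h1.le)] at h
  simp only [ENNReal.toReal_ofReal (Real.exp_pos _).le, smul_eq_mul] at h
  exact h.symm

lemma integrable_exp_sq {v b : ℝ} (hv : 0 < v) (hb : b * v < 1) :
    Integrable (fun z => Real.exp (b * ‖z‖ ^ 2)) (complexGaussian v.toNNReal) := by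
  simpa using (integrable_exp_mul_iff hv hb (F := fun _ => 1)).2 (integrable_const 1)

lemma integral_exp_sq {v b : ℝ} (hv : 0 < v) (hb : b * v < 1) :
    ∫ z, Real.exp (b * ‖z‖ ^ 2) ∂complexGaussian v.toNNReal = (1 - b * v)⁻¹ := by
  simpa using integral_exp_mul hv hb (fun _ => 1)

variable {v t : ℝ}

lemma spread_mul_lt_one (hv : 0 < v) (ht : 0 < t) : t / (1 + t) / v * v < 1 := by
  rw [div_mul_cancel₀ _ hv.ne', div_lt_one (by positivity)]; linarith

lemma half_spread_mul_lt_one (hv : 0 < v) (ht : 0 < t) : t / (1 + t) / v / 2 * v < 1 := by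
  have := spread_mul_lt_one hv ht
  have h0 : 0 < t / (1 + t) / v * v := by positivity
  linarith

lemma integrable_spreadRatio (hv : 0 < v) (ht : 0 < t) :
    Integrable (spreadRatio v t) (complexGaussian v.toNNReal) :=
  (integrable_exp_sq hv (spread_mul_lt_one hv ht)).const_mul _

lemma integral_spreadRatio (hv : 0 < v) (ht : 0 < t) :
    ∫ z, spreadRatio v t z ∂complexGaussian v.toNNReal = 1 := by
  unfold spreadRatio
  rw [integral_const_mul, integral_exp_sq hv (spread_mul_lt_one hv ht)]
  field_simp; ring

lemma log_spreadRatio (ht : 0 < t) (z : ℂ) :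
    Real.log (spreadRatio v t z) = t / (1 + t) / v * ‖z‖ ^ 2 - Real.log (1 + t) := by
  unfold spreadRatio
  rw [Real.log_mul (by positivity) (Real.exp_pos _).ne', Real.log_exp, Real.log_inv]
  ring

lemma spreadRatio_mul_log (ht : 0 < t) (z : ℂ) :
    spreadRatio v t z * Real.log (spreadRatio v t z)
      = (1 + t)⁻¹ * (t / (1 + t) / v) * (Real.exp (t / (1 + t) / v * ‖z‖ ^ 2) * ‖z‖ ^ 2)
        - Real.log (1 + t) * spreadRatio v t z := by
  rw [log_spreadRatio ht]; unfold spreadRatio; ring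

lemma integrable_norm_sq_complexGaussian (v : ℝ≥0) :
    Integrable (fun z : ℂ => ‖z‖ ^ 2) (complexGaussian v) :=
  (memLp_two_iff_integrable_sq_norm (by fun_prop)).1 (memLp_id_complexGaussian v)

lemma integrable_spreadRatio_mul_log (hv : 0 < v) (ht : 0 < t) :
    Integrable (fun z => spreadRatio v t z * Real.log (spreadRatio v t z))
      (complexGaussian v.toNNReal) := by
  simp_rw [spreadRatio_mul_log ht]
  refine Integrable.sub (Integrable.const_mul ?_ _) ((integrable_spreadRatio hv ht).const_mul _)
  exact (integrable_exp_mul_iff hv (spread_mul_lt_one hv ht)).2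
    (integrable_norm_sq_complexGaussian _)

/-- The relative entropy of `CN(0, v (1 + t))` with respect to `CN(0, v)`. -/
lemma integral_spreadRatio_mul_log (hv : 0 < v) (ht : 0 < t) :
    ∫ z, spreadRatio v t z * Real.log (spreadRatio v t z) ∂complexGaussian v.toNNReal
      = t - Real.log (1 + t) := by
  have hb := spread_mul_lt_one hv ht
  simp_rw [spreadRatio_mul_log ht]
  rw [integral_sub (Integrable.const_mul ((integrable_exp_mul_iff hv hb).2
      (integrable_norm_sq_complexGaussian _)) _) ((integrable_spreadRatio hv ht).const_mul _),
    integral_const_mul, integral_const_mul, integral_spreadRatio hv ht,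
    integral_exp_mul hv hb (fun z => ‖z‖ ^ 2), integral_norm_sq_complexGaussian]
  have h1 : 1 - t / (1 + t) / v * v = (1 + t)⁻¹ := by field_simp; ring
  rw [h1, Real.coe_toNNReal _ (by positivity)]
  field_simp

/-- The decoding metric `√r / (1 + t) ^ (1 / 2)` belonging to the likelihood ratio
`r = spreadRatio v t`. -/
noncomputable def decodingMetric (v t : ℝ) (z : ℂ) : ℝ :=
  (1 + t)⁻¹ * Real.exp (t / (1 + t) / v / 2 * ‖z‖ ^ 2)

@[fun_prop]
lemma measurable_decodingMetric (v t : ℝ) : Measurable (decodingMetric v t) := by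
  unfold decodingMetric; fun_prop

lemma decodingMetric_pos (ht : 0 < t) (z : ℂ) : 0 < decodingMetric v t z := by
  unfold decodingMetric; positivity

/-- The prefactor `(1 + t)⁻¹` of the metric is chosen to cancel here. It makes the overlaps
asymmetric, with det Σ_m alone in the numerator, where the plain square root of the density would
give a geometric mean of two determinants. -/
lemma spreadRatio_div_decodingMetric (ht : 0 < t) (z : ℂ) :
    spreadRatio v t z / decodingMetric v t z = Real.exp (t / (1 + t) / v / 2 * ‖z‖ ^ 2) := by
  unfold spreadRatio decodingMetric
  rw [mul_div_mul_left _ _ (by positivity), ← Real.exp_sub]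
  congr 1; ring

lemma one_sub_half_spread (hv : 0 < v) (ht : 0 < t) :
    (1 - t / (1 + t) / v / 2 * v)⁻¹ = (1 + t) / (1 + t / 2) := by
  have : 1 - t / (1 + t) / v / 2 * v = (1 + t / 2) / (1 + t) := by field_simp; ring
  rw [this, inv_div]

lemma integral_decodingMetric (hv : 0 < v) (ht : 0 < t) :
    ∫ z, decodingMetric v t z ∂complexGaussian v.toNNReal = (1 + t / 2)⁻¹ := by
  unfold decodingMetric
  rw [integral_const_mul, integral_exp_sq hv (half_spread_mul_lt_one hv ht),
    one_sub_half_spread hv ht]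
  field_simp

lemma integrable_decodingMetric (hv : 0 < v) (ht : 0 < t) :
    Integrable (decodingMetric v t) (complexGaussian v.toNNReal) :=
  (integrable_exp_sq hv (half_spread_mul_lt_one hv ht)).const_mul _

lemma integral_spreadRatio_div (hv : 0 < v) (ht : 0 < t) :
    ∫ z, spreadRatio v t z / decodingMetric v t z ∂complexGaussian v.toNNReal
      = (1 + t) / (1 + t / 2) := by
  simp_rw [spreadRatio_div_decodingMetric ht]
  rw [integral_exp_sq hv (half_spread_mul_lt_one hv ht), one_sub_half_spread hv ht]

lemma integrable_spreadRatio_div (hv : 0 < v) (ht : 0 < t) :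
    Integrable (fun z => spreadRatio v t z / decodingMetric v t z)
      (complexGaussian v.toNNReal) := by
  simp_rw [spreadRatio_div_decodingMetric ht]
  exact integrable_exp_sq hv (half_spread_mul_lt_one hv ht)

variable {N : ℕ} {v t : Fin N → ℝ}

/-- The overlap of the `m`-th and the `m'`-th component of the mixture. -/
noncomputable def overlap (t : Fin N → ℝ) (m m' : Fin N) : ℝ :=
  if m = m' then 1 else (1 + t m) / ((1 + t m / 2) * (1 + t m' / 2))

lemma overlap_pos (ht : ∀ i, 0 < t i) (m m' : Fin N) : 0 < overlap t m m' := by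
  have := ht m
  have := ht m'
  unfold overlap
  split_ifs <;> positivity

lemma integrable_eval_diagGaussian {F : ℂ → ℝ} {m : Fin N}
    (hF : Integrable F (complexGaussian (v m).toNNReal)) :
    Integrable (fun y => F (y m)) (diagGaussian v) :=
  integrable_comp_eval (μ := fun i => complexGaussian (v i).toNNReal) hF

lemma integral_eval_diagGaussian {F : ℂ → ℝ} {m : Fin N} (hF : Measurable F) :
    ∫ y, F (y m) ∂diagGaussian v = ∫ z, F z ∂complexGaussian (v m).toNNReal :=
  integral_comp_eval (μ := fun i => complexGaussian (v i).toNNReal) hF.aestronglyMeasurable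

/-- For m = m' the metric cancels and the total mass of a density remains, hence the case
distinction in `overlap`. For m ≠ m' the two factors depend on independent coordinates. -/
lemma overlap_integral (hv : ∀ i, 0 < v i) (ht : ∀ i, 0 < t i) (m m' : Fin N) :
    Integrable (fun y => spreadRatio (v m) (t m) (y m) / decodingMetric (v m) (t m) (y m)
      * decodingMetric (v m') (t m') (y m')) (diagGaussian v) ∧
    ∫ y, spreadRatio (v m) (t m) (y m) / decodingMetric (v m) (t m) (y m)
      * decodingMetric (v m') (t m') (y m') ∂diagGaussian v = overlap t m m' := by
  have hm1 : Measurable fun z => spreadRatio (v m) (t m) z / decodingMetric (v m) (t m) z := by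
    fun_prop
  have hm2 : Measurable (decodingMetric (v m') (t m')) := by fun_prop
  have hi1 := integrable_eval_diagGaussian (integrable_spreadRatio_div (hv m) (ht m))
  have hi2 := integrable_eval_diagGaussian (integrable_decodingMetric (hv m') (ht m'))
  by_cases h : m = m'
  · subst h
    simp_rw [div_mul_cancel₀ _ (decodingMetric_pos (v := v m) (ht m) _).ne']
    refine ⟨integrable_eval_diagGaussian (integrable_spreadRatio (hv m) (ht m)), ?_⟩
    rw [integral_eval_diagGaussian (by fun_prop), integral_spreadRatio (hv m) (ht m)]
    simp [overlap]
  · have hind : iIndepFun (fun i (y : Fin N → ℂ) => y i) (diagGaussian v) :=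
      iIndepFun_pi (X := fun _ z => z) (fun i => by fun_prop)
    have hind2 := (hind.indepFun h).comp hm1 hm2
    refine ⟨hind2.integrable_mul hi1 hi2, ?_⟩
    have := hind2.integral_fun_mul_eq_mul_integral (by exact hi1.aestronglyMeasurable)
      (by exact hi2.aestronglyMeasurable)
    simp only [Function.comp] at this
    rw [this, integral_eval_diagGaussian hm1, integral_eval_diagGaussian hm2,
      integral_spreadRatio_div (hv m) (ht m), integral_decodingMetric (hv m') (ht m')]
    have := ht m
    have := ht m'
    simp only [overlap, h, if_false]
    field_simp

/-- Pointwise bound behind the mismatched-decoding bound on the entropy of a mixture: `r m` are the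
component densities, `ψ m` decoding metrics and `c m` normalizing constants. -/
lemma mixture_mul_log_le {N : ℕ} [NeZero N] {r ψ c : Fin N → ℝ} (hr : ∀ m, 0 < r m)
    (hψ : ∀ m, 0 < ψ m) (hc : ∀ m, 0 < c m) :
    ((N : ℝ)⁻¹ * ∑ m, r m) * Real.log ((N : ℝ)⁻¹ * ∑ m, r m) ≤
      (N : ℝ)⁻¹ * ∑ m, (r m * Real.log (r m) - r m + (c m)⁻¹ * ((N : ℝ)⁻¹ *
        ∑ m', r m / ψ m * ψ m') + r m * Real.log (c m)) := by
  have hN : 0 < (N : ℝ) := Nat.cast_pos.2 (NeZero.pos N)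
  set f := (N : ℝ)⁻¹ * ∑ m, r m with hf
  set Ψ := (N : ℝ)⁻¹ * ∑ m, ψ m with hΨ
  have hf0 : 0 < f := mul_pos (inv_pos.2 hN)
    (Finset.sum_pos (fun m _ => hr m) Finset.univ_nonempty)
  have hΨ0 : 0 < Ψ := mul_pos (inv_pos.2 hN)
    (Finset.sum_pos (fun m _ => hψ m) Finset.univ_nonempty)
  clear_value f Ψ
  have h1 : ∀ m, r m * Real.log f ≤ f / Ψ * ψ m - r m
      + (r m * Real.log (r m) - r m + (c m)⁻¹ * (r m / ψ m * Ψ) + r m * Real.log (c m)) := by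
    intro m
    have hrm := hr m
    have hψm := hψ m
    have hcm := hc m
    -- `a1` compares the mismatched posterior ψ_m / (N Ψ) with the true one r_m / (N f); `a2` is the
    -- tangent to the logarithm at `c m`, evaluated at Ψ / ψ_m.
    have a1 := Real.log_le_sub_one_of_pos (x := f * ψ m / (r m * Ψ)) (by positivity)
    have a2 := Real.log_le_sub_one_of_pos (x := Ψ / (ψ m * c m)) (by positivity)
    rw [Real.log_div (by positivity) (by positivity), Real.log_mul (by positivity) (by positivity),
      Real.log_mul (by positivity) (by positivity)] at a1
    rw [Real.log_div (by positivity) (by positivity),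
      Real.log_mul (by positivity) (by positivity)] at a2
    have a3 : Real.log f ≤ f * ψ m / (r m * Ψ) - 1 + Real.log (r m) + Ψ / (ψ m * c m) - 1
        + Real.log (c m) := by linarith
    have a4 := mul_le_mul_of_nonneg_left a3 hrm.le
    refine a4.trans (le_of_eq ?_)
    field_simp
    ring
  have h2 : f * Real.log f = (N : ℝ)⁻¹ * ∑ m, r m * Real.log f := by
    rw [hf, ← Finset.sum_mul, mul_assoc]
  -- Both posteriors sum to 1, so the error terms of Gibbs' inequality cancel on averaging over m.
  have h3 : (N : ℝ)⁻¹ * ∑ m, (f / Ψ * ψ m - r m) = 0 := by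
    rw [Finset.sum_sub_distrib, ← Finset.mul_sum, mul_sub, ← hf, mul_left_comm, ← hΨ,
      div_mul_cancel₀ _ hΨ0.ne', sub_self]
  have h4 : ∀ m, (N : ℝ)⁻¹ * ∑ m', r m / ψ m * ψ m' = r m / ψ m * Ψ := fun m => by
    rw [← Finset.mul_sum, mul_left_comm, ← hΨ]
  simp_rw [h4]
  rw [h2]
  calc _ ≤ (N : ℝ)⁻¹ * ∑ m, (f / Ψ * ψ m - r m
      + (r m * Real.log (r m) - r m + (c m)⁻¹ * (r m / ψ m * Ψ) + r m * Real.log (c m))) := by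
        gcongr with m; exact h1 m
    _ = _ := by rw [Finset.sum_add_distrib, mul_add, h3, zero_add]

/-- Upper bound on the relative entropy of the Gaussian mixture with respect to `CN(0, diag v)`. -/
lemma integral_mixRatio_mul_log_le [NeZero N] (hv : ∀ i, 0 < v i) (ht : ∀ i, 0 < t i)
    (hint : Integrable (fun y => mixRatio v t y * Real.log (mixRatio v t y)) (diagGaussian v)) :
    ∫ y, mixRatio v t y * Real.log (mixRatio v t y) ∂diagGaussian v ≤
      (N : ℝ)⁻¹ * ∑ m, (t m - Real.log (1 + t m)
        + Real.log ((N : ℝ)⁻¹ * ∑ m', overlap t m m')) := by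
  have hN : 0 < (N : ℝ) := Nat.cast_pos.2 (NeZero.pos N)
  set c : Fin N → ℝ := fun m => (N : ℝ)⁻¹ * ∑ m', overlap t m m' with hc
  have hc0 : ∀ m, 0 < c m := fun m => mul_pos (inv_pos.2 hN)
    (Finset.sum_pos (fun m' _ => overlap_pos ht m m') Finset.univ_nonempty)
  have i1 := fun m => integrable_eval_diagGaussian
    (integrable_spreadRatio_mul_log (hv m) (ht m))
  have i2 := fun m => integrable_eval_diagGaussian (integrable_spreadRatio (hv m) (ht m))
  have i3 := fun m => ((integrable_finsetSum Finset.univ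
    (fun m' _ => (overlap_integral hv ht m m').1)).const_mul (N : ℝ)⁻¹).const_mul (c m)⁻¹
  have i4 := fun m => (i2 m).mul_const (Real.log (c m))
  have i12 := fun m => (i1 m).sub (i2 m)
  simp only [Pi.sub_def] at i12
  have i123 := fun m => (i12 m).add (i3 m)
  simp only [Pi.add_def] at i123
  have iall := fun m => (i123 m).add (i4 m)
  simp only [Pi.add_def] at iall
  have hval : ∀ m, ∫ y, (spreadRatio (v m) (t m) (y m) * Real.log (spreadRatio (v m) (t m) (y m))
      - spreadRatio (v m) (t m) (y m) + (c m)⁻¹ * ((N : ℝ)⁻¹ *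
        ∑ m', spreadRatio (v m) (t m) (y m) / decodingMetric (v m) (t m) (y m)
          * decodingMetric (v m') (t m') (y m'))
      + spreadRatio (v m) (t m) (y m) * Real.log (c m)) ∂diagGaussian v
      = t m - Real.log (1 + t m) + Real.log (c m) := by
    intro m
    rw [integral_add (i123 m) (i4 m), integral_add (i12 m) (i3 m), integral_sub (i1 m) (i2 m),
      integral_mul_const, integral_const_mul, integral_const_mul,
      integral_finsetSum _ (fun m' _ => (overlap_integral hv ht m m').1)]
    simp_rw [(overlap_integral hv ht m _).2]
    rw [integral_eval_diagGaussian
        (F := fun z => spreadRatio (v m) (t m) z * Real.log (spreadRatio (v m) (t m) z))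
        (by fun_prop), integral_eval_diagGaussian (by fun_prop),
      integral_spreadRatio_mul_log (hv m) (ht m), integral_spreadRatio (hv m) (ht m)]
    -- `c m` is the mean of Ψ / ψ_m under r_m, so the tangent term integrates to 1 and cancels the
    -- mass of r_m; only log c_m is left.
    have : (c m)⁻¹ * ((N : ℝ)⁻¹ * ∑ m', overlap t m m') = 1 := inv_mul_cancel₀ (hc0 m).ne'
    rw [this]; ring
  have hle := integral_mono hint ((integrable_finsetSum Finset.univ
    fun m _ => iall m).const_mul (N : ℝ)⁻¹) (fun y => mixture_mul_log_le
      (r := fun m => spreadRatio (v m) (t m) (y m))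
      (ψ := fun m => decodingMetric (v m) (t m) (y m))
      (fun m => spreadRatio_pos (ht m) _) (fun m => decodingMetric_pos (ht m) _) hc0)
  refine hle.trans (le_of_eq ?_)
  rw [integral_const_mul, integral_finsetSum _ fun m _ => iall m]
  congr 1
  exact Finset.sum_congr rfl fun m _ => hval m

end

/-! ### Mutual information of the equivalent channel. -/

section

lemma log_shiftRatio_add (v c : ℝ) (x w : ℂ) :
    Real.log (shiftRatio v (c * x) (c * x + w))
      = (c ^ 2 * ‖x‖ ^ 2 + 2 * c * (star x * w).re) / v := by
  rw [shiftRatio, Real.log_exp]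
  congr 1
  have h : ‖(c : ℂ) * x‖ ^ 2 = c ^ 2 * ‖x‖ ^ 2 := by
    rw [norm_mul, mul_pow, Complex.norm_real, Real.norm_eq_abs, sq_abs]
  have h2 : ‖x‖ ^ 2 = x.re * x.re + x.im * x.im := by
    rw [← Complex.normSq_eq_norm_sq, Complex.normSq_apply]
  rw [h, h2]
  simp [Complex.mul_re, Complex.mul_im]
  ring

lemma log_vecShiftRatio_add {N : ℕ} (v : Fin N → ℝ) (c : ℝ) (x w : Fin N → ℂ) :
    Real.log (vecShiftRatio v ((c : ℂ) • x) ((c : ℂ) • x + w))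
      = ∑ i, (c ^ 2 * ‖x i‖ ^ 2 + 2 * c * (star (x i) * w i).re) / v i := by
  rw [vecShiftRatio, Real.log_prod fun i _ => (shiftRatio_pos _ _ _).ne']
  exact Finset.sum_congr rfl fun i _ => log_shiftRatio_add _ _ _ _

/-- A mixture of exponentials of quadratic forms has a logarithm of at most quadratic growth, so
second moments of the output suffice for integrability of log f. -/
lemma abs_log_mixRatio_le {N : ℕ} [NeZero N] {v t : Fin N → ℝ} (hv : ∀ i, 0 < v i)
    (ht : ∀ i, 0 < t i) :
    ∃ C, ∀ y : Fin N → ℂ, |Real.log (mixRatio v t y)|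
      ≤ C + ∑ i, t i / (1 + t i) / v i * ‖y i‖ ^ 2 := by
  have hN : 0 < (N : ℝ) := Nat.cast_pos.2 (NeZero.pos N)
  have hκ : ∀ i, 0 ≤ t i / (1 + t i) / v i := fun i => by
    have := ht i; have := hv i; positivity
  -- Lower bound: keep one component of the mixture, here index 0, and drop its exponential, which
  -- is at least 1.
  set C := Real.log ((N : ℝ)⁻¹ * (1 + t 0)⁻¹) with hC
  have h0 : 0 < 1 + t 0 := by have := ht 0; positivity
  have hsum : ∀ y : Fin N → ℂ, 0 ≤ ∑ i, t i / (1 + t i) / v i * ‖y i‖ ^ 2 := fun y =>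
    Finset.sum_nonneg fun i _ => mul_nonneg (hκ i) (sq_nonneg _)
  refine ⟨|C|, fun y => abs_le.2 ⟨?_, ?_⟩⟩
  · have h1 : C ≤ Real.log (mixRatio v t y) := by
      refine Real.log_le_log (by positivity) ?_
      unfold mixRatio
      gcongr
      refine le_trans ?_ (Finset.single_le_sum
        (f := fun m => spreadRatio (v m) (t m) (y m)) (fun m _ => (spreadRatio_pos (ht m) _).le)
        (Finset.mem_univ 0))
      unfold spreadRatio
      refine le_mul_of_one_le_right (by positivity) (Real.one_le_exp ?_)
      exact mul_nonneg (hκ 0) (sq_nonneg _)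
    have := neg_abs_le C
    have := hsum y
    linarith
  · have h1 : Real.log (mixRatio v t y) ≤ ∑ i, t i / (1 + t i) / v i * ‖y i‖ ^ 2 := by
      rw [Real.log_le_iff_le_exp (mixRatio_pos ht y)]
      unfold mixRatio
      rw [inv_mul_le_iff₀ hN]
      calc _ ≤ ∑ _m : Fin N, Real.exp (∑ i, t i / (1 + t i) / v i * ‖y i‖ ^ 2) := by
            refine Finset.sum_le_sum fun m _ => ?_
            unfold spreadRatio
            refine (mul_le_of_le_one_left (Real.exp_pos _).le (inv_le_one_of_one_le₀ ?_)).trans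
              (Real.exp_le_exp.2 ?_)
            · have := ht m; linarith
            · exact Finset.single_le_sum
                (f := fun i => t i / (1 + t i) / v i * ‖y i‖ ^ 2)
                (fun i _ => mul_nonneg (hκ i) (sq_nonneg _)) (Finset.mem_univ m)
        _ = _ := by simp
    have := abs_nonneg C
    linarith

section Channel

variable {Ω : Type*} [MeasurableSpace Ω] {P : Measure Ω} {N : ℕ}
  {v : Fin N → ℝ} {s : Ω → ℂ} {a : Ω → Fin N} {w : Ω → Fin N → ℂ}

lemma aemeasurable_smSymbol (hs : AEMeasurable s P) (ha : Measurable a) :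
    AEMeasurable (fun ω => smSymbol (s ω) (a ω)) P :=
  measurable_smSymbol.comp_aemeasurable (hs.prodMk ha.aemeasurable)

lemma memLp_of_hasLaw_complexGaussian {X : Ω → ℂ} {u : ℝ≥0}
    (hX : HasLaw X (complexGaussian u) P) : MemLp X 2 P := by
  have h := memLp_id_complexGaussian u
  rw [← hX.map_eq] at h
  exact h.comp_of_map hX.aemeasurable

lemma memLp_smSymbol (hs : HasLaw s (complexGaussian 1) P) (ha : Measurable a) (i : Fin N) :
    MemLp (fun ω => smSymbol (s ω) (a ω) i) 2 P := by
  refine (memLp_of_hasLaw_complexGaussian hs).of_le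
    (aemeasurable_pi_iff.1 (aemeasurable_smSymbol hs.aemeasurable ha) i).aestronglyMeasurable
    (ae_of_all _ fun ω => ?_)
  unfold smSymbol
  by_cases h : i = a ω
  · subst h; simp
  · simp [Pi.single_eq_of_ne h]

lemma integral_norm_sq_of_hasLaw {X : Ω → ℂ} {u : ℝ≥0}
    (hX : HasLaw X (complexGaussian u) P) : ∫ ω, ‖X ω‖ ^ 2 ∂P = u := by
  rw [← integral_norm_sq_complexGaussian u]
  exact hX.integral_comp (f := fun z : ℂ => ‖z‖ ^ 2) (by fun_prop)

lemma integral_norm_sq_smSymbol [IsProbabilityMeasure P] (hs : HasLaw s (complexGaussian 1) P) (ha : Measurable a)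
    (ha_unif : ∀ m, P (a ⁻¹' {m}) = (N : ℝ≥0∞)⁻¹) (hind : IndepFun s a P) (i : Fin N) :
    ∫ ω, ‖smSymbol (s ω) (a ω) i‖ ^ 2 ∂P = (N : ℝ)⁻¹ := by
  have hx := aemeasurable_pi_iff.1 (aemeasurable_smSymbol hs.aemeasurable ha) i
  have h := lintegral_smSymbol hs ha ha_unif hind
    (F := fun x => ENNReal.ofReal (‖x i‖ ^ 2)) (by fun_prop)
  rw [integral_eq_lintegral_of_nonneg_ae (ae_of_all _ fun ω => by positivity)
    (hx.norm.pow_const 2).aestronglyMeasurable, h, Finset.sum_eq_single i]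
  · have h2 : ∫⁻ z, ENNReal.ofReal (‖smSymbol z i i‖ ^ 2) ∂complexGaussian 1 = 1 := by
      simp only [smSymbol, Pi.single_eq_same]
      rw [← ofReal_integral_eq_lintegral_ofReal (integrable_norm_sq_complexGaussian 1)
        (ae_of_all _ fun z => by positivity), integral_norm_sq_complexGaussian]
      simp
    rw [h2]; simp
  · intro m _ hm
    simp [smSymbol, Pi.single_eq_of_ne hm.symm]
  · simp

/-- The density of the output law of the equivalent channel at `y`. -/
lemma lintegral_vecShiftRatio_smSymbol [IsProbabilityMeasure P] (hv : ∀ i, 0 < v i) (hs : HasLaw s (complexGaussian 1) P)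
    (ha : Measurable a) (ha_unif : ∀ m, P (a ⁻¹' {m}) = (N : ℝ≥0∞)⁻¹) (hind : IndepFun s a P)
    (c : ℝ) (y : Fin N → ℂ) :
    ∫⁻ x, ENNReal.ofReal (vecShiftRatio v ((c : ℂ) • x) y)
        ∂P.map (fun ω => smSymbol (s ω) (a ω))
      = ENNReal.ofReal (mixRatio v (fun i => c ^ 2 / v i) y) := by
  have hm := (measurable_vecShiftRatio_left v c y).ennreal_ofReal
  rw [lintegral_map' hm.aemeasurable (aemeasurable_smSymbol hs.aemeasurable ha),
    lintegral_smSymbol hs ha ha_unif hind hm]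
  simp_rw [vecShiftRatio_smSymbol, lintegral_shiftRatio (hv _)]
  have h0 : ∀ m, 0 ≤ spreadRatio (v m) (c ^ 2 / v m) (y m) := fun m => by
    have := hv m
    unfold spreadRatio; positivity
  rw [mixRatio, ← Finset.mul_sum, ENNReal.ofReal_mul (by positivity),
    ENNReal.ofReal_sum_of_nonneg fun m _ => h0 m]
  rcases Nat.eq_zero_or_pos N with rfl | hN
  · simp
  · rw [ENNReal.ofReal_inv_of_pos (Nat.cast_pos.2 hN), ENNReal.ofReal_natCast]

lemma indepFun_noise_smSymbol (hw_ind : IndepFun w (fun ω => (s ω, a ω)) P) :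
    IndepFun w (fun ω => smSymbol (s ω) (a ω)) P :=
  hw_ind.comp measurable_id measurable_smSymbol

/-- The joint law of output and input of the equivalent channel. -/
lemma map_output_input [IsProbabilityMeasure P] (hv : ∀ i, 0 < v i) (hs : AEMeasurable s P) (ha : Measurable a)
    (hw : HasLaw w (diagGaussian v) P) (hw_ind : IndepFun w (fun ω => (s ω, a ω)) P) (c : ℝ) :
    P.map (fun ω => ((c : ℂ) • smSymbol (s ω) (a ω) + w ω, smSymbol (s ω) (a ω)))
      = ((diagGaussian v).prod (P.map fun ω => smSymbol (s ω) (a ω))).withDensity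
          (fun p => ENNReal.ofReal (vecShiftRatio v ((c : ℂ) • p.2) p.1)) := by
  have hx := aemeasurable_smSymbol hs ha
  rw [← map_channel_eq_withDensity hv, ← hw.map_eq,
    ← (indepFun_iff_map_prod_eq_prod_map_map hw.aemeasurable hx).1
      (indepFun_noise_smSymbol hw_ind),
    AEMeasurable.map_map_of_aemeasurable (by fun_prop) (hw.aemeasurable.prodMk hx)]
  rfl

/-- Integrating the joint density over the input leaves the mixture density. -/
lemma map_output [IsProbabilityMeasure P] (hv : ∀ i, 0 < v i) (hs : HasLaw s (complexGaussian 1) P) (ha : Measurable a)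
    (ha_unif : ∀ m, P (a ⁻¹' {m}) = (N : ℝ≥0∞)⁻¹) (hind : IndepFun s a P)
    (hw : HasLaw w (diagGaussian v) P) (hw_ind : IndepFun w (fun ω => (s ω, a ω)) P) (c : ℝ) :
    P.map (fun ω => (c : ℂ) • smSymbol (s ω) (a ω) + w ω)
      = (diagGaussian v).withDensity
          (fun y => ENNReal.ofReal (mixRatio v (fun i => c ^ 2 / v i) y)) := by
  have hx := aemeasurable_smSymbol hs.aemeasurable ha
  have hy : AEMeasurable (fun ω => (c : ℂ) • smSymbol (s ω) (a ω) + w ω) P :=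
    (hx.const_smul (c : ℂ)).add hw.aemeasurable
  have hJ := map_output_input hv hs.aemeasurable ha hw hw_ind c
  have hL := (measurable_vecShiftRatio v c).ennreal_ofReal
  have : IsProbabilityMeasure (P.map fun ω => smSymbol (s ω) (a ω)) :=
    Measure.isProbabilityMeasure_map hx
  refine Measure.ext_of_lintegral _ fun F hF => ?_
  have hF1 : Measurable fun p : (Fin N → ℂ) × (Fin N → ℂ) => F p.1 := hF.comp measurable_fst
  have h1 := lintegral_map' (f := fun p : (Fin N → ℂ) × (Fin N → ℂ) => F p.1)
    hF1.aemeasurable (hy.prodMk hx)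
  rw [lintegral_map' hF.aemeasurable hy, ← h1, hJ,
    lintegral_withDensity_eq_lintegral_mul _ hL hF1, lintegral_prod _ (hL.mul hF1).aemeasurable,
    lintegral_withDensity_eq_lintegral_mul _ (by fun_prop) hF]
  refine lintegral_congr fun y => ?_
  simp only [Pi.mul_apply]
  rw [lintegral_mul_const _ (measurable_vecShiftRatio_left v c y).ennreal_ofReal,
    lintegral_vecShiftRatio_smSymbol hv hs ha ha_unif hind]

/-- The mutual information of the equivalent channel, as a relative entropy. -/
lemma mutualInfo_channel [IsProbabilityMeasure P] [NeZero N] (hv : ∀ i, 0 < v i) (hs : HasLaw s (complexGaussian 1) P)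
    (ha : Measurable a) (ha_unif : ∀ m, P (a ⁻¹' {m}) = (N : ℝ≥0∞)⁻¹) (hind : IndepFun s a P)
    (hw : HasLaw w (diagGaussian v) P) (hw_ind : IndepFun w (fun ω => (s ω, a ω)) P)
    {c : ℝ} (hc : c ≠ 0) :
    mutualInfo P (fun ω => (c : ℂ) • smSymbol (s ω) (a ω) + w ω)
      (fun ω => smSymbol (s ω) (a ω)) ≠ ∞ ∧
    Integrable (fun y => mixRatio v (fun i => c ^ 2 / v i) y
      * Real.log (mixRatio v (fun i => c ^ 2 / v i) y)) (diagGaussian v) ∧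
    (mutualInfo P (fun ω => (c : ℂ) • smSymbol (s ω) (a ω) + w ω)
      (fun ω => smSymbol (s ω) (a ω))).toReal
      = (N : ℝ)⁻¹ * ∑ m, c ^ 2 / v m - ∫ y, mixRatio v (fun i => c ^ 2 / v i) y
          * Real.log (mixRatio v (fun i => c ^ 2 / v i) y) ∂diagGaussian v := by
  set x : Ω → Fin N → ℂ := fun ω => smSymbol (s ω) (a ω) with hxdef
  set y : Ω → Fin N → ℂ := fun ω => (c : ℂ) • x ω + w ω with hydef
  set t : Fin N → ℝ := fun i => c ^ 2 / v i with htdef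
  have ht : ∀ i, 0 < t i := fun i => div_pos (by positivity) (hv i)
  have hx : AEMeasurable x P := aemeasurable_smSymbol hs.aemeasurable ha
  have hy : AEMeasurable y P := (hx.const_smul (c : ℂ)).add hw.aemeasurable
  have hμX : IsProbabilityMeasure (P.map x) := Measure.isProbabilityMeasure_map hx
  have hμY : IsProbabilityMeasure (P.map y) := Measure.isProbabilityMeasure_map hy
  have hμJ : IsProbabilityMeasure (P.map fun ω => (y ω, x ω)) :=
    Measure.isProbabilityMeasure_map (hy.prodMk hx)
  have hJ := map_output_input hv hs.aemeasurable ha hw hw_ind c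
  have hY := map_output hv hs ha ha_unif hind hw hw_ind c
  change P.map (fun ω => (y ω, x ω)) = ((diagGaussian v).prod (P.map x)).withDensity _ at hJ
  change P.map y = (diagGaussian v).withDensity (fun y => ENNReal.ofReal (mixRatio v t y)) at hY
  have hprod : (P.map y).prod (P.map x) = ((diagGaussian v).prod (P.map x)).withDensity
      (fun p => ENNReal.ofReal (mixRatio v t p.1)) := by
    rw [hY, prod_withDensity_left (by fun_prop)]
  obtain ⟨hac, hllr⟩ := llr_withDensity_ofReal (μ := (diagGaussian v).prod (P.map x))
    (measurable_vecShiftRatio v c) (q := fun p => mixRatio v t p.1) (by fun_prop)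
    (fun p => vecShiftRatio_pos _ _ _) (fun p => mixRatio_pos ht _)
  rw [← hJ, ← hprod] at hac hllr
  -- second moments
  have hx2 : ∀ i, MemLp (fun ω => x ω i) 2 P := fun i => memLp_smSymbol hs ha i
  have hwi : ∀ i, HasLaw (fun ω => w ω i) (complexGaussian (v i).toNNReal) P := fun i =>
    (measurePreserving_eval (fun i => complexGaussian (v i).toNNReal) i).fun_comp_hasLaw hw
  have hw2 : ∀ i, MemLp (fun ω => w ω i) 2 P := fun i => memLp_of_hasLaw_complexGaussian (hwi i)
  have hxw : ∀ i, Integrable (fun ω => star (x ω i) * w ω i) P := fun i =>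
    (hx2 i).star.integrable_mul (hw2 i)
  have hxn : ∀ i, Integrable (fun ω => ‖x ω i‖ ^ 2) P := fun i =>
    (memLp_two_iff_integrable_sq_norm (hx2 i).1).1 (hx2 i)
  have hterm1 : ∀ i, Integrable (fun ω => c ^ 2 * ‖x ω i‖ ^ 2) P := fun i => (hxn i).const_mul _
  have hterm2 : ∀ i, Integrable (fun ω => 2 * c * (star (x ω i) * w ω i).re) P := fun i =>
    (hxw i).re.const_mul _
  have hterm : ∀ i, Integrable
      (fun ω => (c ^ 2 * ‖x ω i‖ ^ 2 + 2 * c * (star (x ω i) * w ω i).re) / v i) P := fun i =>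
    ((hterm1 i).add (hterm2 i)).div_const _
  -- The noise is centred and independent of the input.
  have hxw0 : ∀ i, ∫ ω, (star (x ω i) * w ω i).re ∂P = 0 := by
    intro i
    have hI : IndepFun (fun ω => star (x ω i)) (fun ω => w ω i) P :=
      (indepFun_noise_smSymbol hw_ind).symm.comp
        (φ := fun z : Fin N → ℂ => star (z i)) (by fun_prop) (measurable_pi_apply i)
    have h1 := hI.integral_fun_mul_eq_mul_integral
      (by exact (hx2 i).star.1) (by exact (hw2 i).1)
    have h2 : ∫ ω, w ω i ∂P = 0 := (hwi i).integral_eq.trans (integral_id_complexGaussian _)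
    simp only [h2, mul_zero] at h1
    have h3 := integral_re (hxw i)
    exact h3.trans (by rw [h1]; simp)
  have hlogL : ∀ ω, Real.log (vecShiftRatio v ((c : ℂ) • x ω) (y ω))
      = ∑ i, (c ^ 2 * ‖x ω i‖ ^ 2 + 2 * c * (star (x ω i) * w ω i).re) / v i := fun ω =>
    log_vecShiftRatio_add v c (x ω) (w ω)
  have hLint : Integrable (fun ω => Real.log (vecShiftRatio v ((c : ℂ) • x ω) (y ω))) P := by
    simp_rw [hlogL]
    exact integrable_finsetSum _ fun i _ => hterm i
  have hLval : ∫ ω, Real.log (vecShiftRatio v ((c : ℂ) • x ω) (y ω)) ∂P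
      = (N : ℝ)⁻¹ * ∑ m, t m := by
    simp_rw [hlogL]
    rw [integral_finsetSum _ fun i _ => hterm i, Finset.mul_sum]
    refine Finset.sum_congr rfl fun i _ => ?_
    rw [integral_div, integral_add (hterm1 i) (hterm2 i), integral_const_mul, integral_const_mul,
      hxw0, integral_norm_sq_smSymbol hs ha ha_unif hind, htdef]
    ring
  have hy2 : ∀ i, Integrable (fun ω => ‖y ω i‖ ^ 2) P := fun i => by
    have h : MemLp (fun ω => y ω i) 2 P := ((hx2 i).const_mul (c : ℂ)).add (hw2 i)
    exact (memLp_two_iff_integrable_sq_norm h.1).1 h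
  have hMint : Integrable (fun ω => Real.log (mixRatio v t (y ω))) P := by
    obtain ⟨C, hC⟩ := abs_log_mixRatio_le hv ht
    refine Integrable.mono' (g := fun ω => C + ∑ i, t i / (1 + t i) / v i * ‖y ω i‖ ^ 2)
      ((integrable_const C).add (integrable_finsetSum _ fun i _ => (hy2 i).const_mul _)) ?_
      (ae_of_all _ fun ω => hC _)
    exact ((measurable_mixRatio v t).log.comp_aemeasurable hy).aestronglyMeasurable
  have hmeas : Measurable fun y => Real.log (mixRatio v t y) := by fun_prop
  -- Integrability of log f under the output law is that of f log f under the reference law.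
  have hMγ : Integrable (fun y => mixRatio v t y * Real.log (mixRatio v t y)) (diagGaussian v) := by
    have h1 := (integrable_map_measure hmeas.aestronglyMeasurable hy).2 hMint
    rw [hY, integrable_withDensity_iff_integrable_smul' (by fun_prop) (by simp)] at h1
    simpa only [ENNReal.toReal_ofReal (mixRatio_pos ht _).le, smul_eq_mul] using h1
  have hMval : ∫ ω, Real.log (mixRatio v t (y ω)) ∂P
      = ∫ y, mixRatio v t y * Real.log (mixRatio v t y) ∂diagGaussian v := by
    rw [← integral_map hy hmeas.aestronglyMeasurable, hY,
      integral_withDensity_eq_integral_toReal_smul (by fun_prop) (by simp)]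
    simp only [ENNReal.toReal_ofReal (mixRatio_pos ht _).le, smul_eq_mul]
  have hdm : Measurable fun p : (Fin N → ℂ) × (Fin N → ℂ) =>
      Real.log (vecShiftRatio v ((c : ℂ) • p.2) p.1) - Real.log (mixRatio v t p.1) :=
    (measurable_vecShiftRatio v c).log.sub (hmeas.comp measurable_fst)
  have hint : Integrable (llr (P.map fun ω => (y ω, x ω)) ((P.map y).prod (P.map x)))
      (P.map fun ω => (y ω, x ω)) := by
    rw [integrable_congr hllr, integrable_map_measure hdm.aestronglyMeasurable (hy.prodMk hx)]
    exact hLint.sub hMint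
  refine ⟨klDiv_ne_top hac hint, hMγ, ?_⟩
  rw [mutualInfo, toReal_klDiv_of_measure_eq hac (by simp), integral_congr_ae hllr,
    integral_map (hy.prodMk hx) hdm.aestronglyMeasurable, integral_sub hLint hMint, hLval, hMval]

end Channel

end

/-! ### Second moments, and the SINR as a ratio of powers. -/

section

section Moments

variable {Ω : Type*} [MeasurableSpace Ω] {P : Measure Ω}

lemma integrable_norm_sq {X : Ω → ℂ} (hX : MemLp X 2 P) : Integrable (fun ω => ‖X ω‖ ^ 2) P :=
  (memLp_two_iff_integrable_sq_norm hX.1).1 hX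

lemma ofReal_norm_sq_eq (z : ℂ) : ((‖z‖ ^ 2 : ℝ) : ℂ) = z * star z := by
  rw [← Complex.normSq_eq_norm_sq, Complex.star_def, Complex.mul_conj]

lemma integral_star {X : Ω → ℂ} : ∫ ω, star (X ω) ∂P = star (∫ ω, X ω ∂P) := integral_conj

lemma integral_norm_sub_integral_sq [IsProbabilityMeasure P] {X : Ω → ℂ} (hX : MemLp X 2 P) :
    ∫ ω, ‖X ω - ∫ ω', X ω' ∂P‖ ^ 2 ∂P = ∫ ω, ‖X ω‖ ^ 2 ∂P - ‖∫ ω, X ω ∂P‖ ^ 2 := by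
  have hXi : Integrable X P := hX.integrable one_le_two
  generalize hc : ∫ ω, X ω ∂P = c
  have h2 : Integrable (fun ω => (star c * X ω).re) P := (hXi.const_mul (star c)).re
  have h3 : ∫ ω, (star c * X ω).re ∂P = ‖c‖ ^ 2 := by
    have h := integral_re (hXi.const_mul (star c))
    refine h.trans ?_
    rw [integral_const_mul, hc, mul_comm, ← ofReal_norm_sq_eq]
    exact Complex.ofReal_re _
  have h4 : Integrable (fun ω => 2 * (star c * X ω).re - ‖c‖ ^ 2) P :=
    (h2.const_mul 2).sub (integrable_const _)
  simp_rw [norm_sub_sq_complex]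
  rw [integral_sub (integrable_norm_sq hX) h4,
    integral_sub (h2.const_mul 2) (integrable_const _), integral_const_mul, h3]
  simp
  ring

/-- The mean power of a combination of uncorrelated signals `U l` with independent random
coefficients `V l`. -/
lemma integral_norm_sq_sum_mul {ι : Type*} [Fintype ι] {U V : ι → Ω → ℂ}
    (hU : ∀ l, MemLp (U l) 2 P) (hV : ∀ l, MemLp (V l) 2 P)
    (hind : IndepFun (fun ω l => V l ω) (fun ω l => U l ω) P)
    (horth : ∀ l l', l ≠ l' → ∫ ω, U l ω * star (U l' ω) ∂P = 0) :
    ∫ ω, ‖∑ l, U l ω * V l ω‖ ^ 2 ∂P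
      = ∑ l, (∫ ω, ‖U l ω‖ ^ 2 ∂P) * ∫ ω, ‖V l ω‖ ^ 2 ∂P := by
  have hU2 : ∀ l l', Integrable (fun ω => U l ω * star (U l' ω)) P := fun l l' =>
    (hU l).integrable_mul (hU l').star
  have hV2 : ∀ l l', Integrable (fun ω => V l ω * star (V l' ω)) P := fun l l' =>
    (hV l).integrable_mul (hV l').star
  have hI : ∀ l l', IndepFun (fun ω => V l ω * star (V l' ω)) (fun ω => U l ω * star (U l' ω)) P :=
    fun l l' => hind.comp (φ := fun z : ι → ℂ => z l * star (z l'))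
      (ψ := fun z : ι → ℂ => z l * star (z l')) (by fun_prop) (by fun_prop)
  have hint : ∀ l l', Integrable
      (fun ω => (V l ω * star (V l' ω)) * (U l ω * star (U l' ω))) P := fun l l' =>
    (hI l l').integrable_mul (hV2 l l') (hU2 l l')
  have hval : ∀ l l', ∫ ω, (V l ω * star (V l' ω)) * (U l ω * star (U l' ω)) ∂P
      = (∫ ω, V l ω * star (V l' ω) ∂P) * ∫ ω, U l ω * star (U l' ω) ∂P := fun l l' =>
    (hI l l').integral_fun_mul_eq_mul_integral (hV2 l l').1 (hU2 l l').1
  have hexp : ∀ ω, ((‖∑ l, U l ω * V l ω‖ ^ 2 : ℝ) : ℂ)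
      = ∑ l, ∑ l', (V l ω * star (V l' ω)) * (U l ω * star (U l' ω)) := fun ω => by
    rw [ofReal_norm_sq_eq, star_sum, Finset.sum_mul_sum]
    refine Finset.sum_congr rfl fun l _ => Finset.sum_congr rfl fun l' _ => ?_
    rw [star_mul']; ring
  -- Over `ℂ` the squared modulus expands into a double sum of products; independence factors each
  -- expectation and `horth` removes the off-diagonal ones.
  apply Complex.ofReal_injective
  rw [← integral_complex_ofReal]
  simp_rw [hexp]
  rw [integral_finsetSum _ fun l _ => integrable_finsetSum _ fun l' _ => hint l l',
    Complex.ofReal_sum]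
  refine Finset.sum_congr rfl fun l _ => ?_
  rw [integral_finsetSum _ fun l' _ => hint l l', Finset.sum_eq_single l]
  · rw [hval, Complex.ofReal_mul, ← integral_complex_ofReal, ← integral_complex_ofReal, mul_comm]
    simp_rw [ofReal_norm_sq_eq]
  · intro l' _ hl'
    rw [hval, horth l l' hl'.symm, mul_zero]
  · simp

end Moments

section Sinr

variable {Ω : Type*} [MeasurableSpace Ω] {P : Measure Ω} {Nt Nr : ℕ}
  {ρfl σ2 : ℝ} {H : Ω → Matrix (Fin Nr) (Fin Nt) ℂ} {g : Fin Nt → Ω → Fin Nr → ℂ}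

/-- The deviation of the effective gain from the mean useful gain. -/
noncomputable def gainError (P : Measure Ω) (H : Ω → Matrix (Fin Nr) (Fin Nt) ℂ)
    (g : Fin Nt → Ω → Fin Nr → ℂ) (m k : Fin Nt) (ω : Ω) : ℂ :=
  combine (g m ω) (fun i => H ω i k) - if k = m then meanGain P H g m m else 0

lemma memLp_gainError [IsProbabilityMeasure P]
    (hgH : ∀ m m', MemLp (fun ω => combine (g m ω) (fun i => H ω i m')) 2 P) (m k : Fin Nt) :
    MemLp (gainError P H g m k) 2 P :=
  (hgH m k).sub (memLp_const _)

/-- The interference-plus-noise power. -/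
lemma sum_gainError_add_noise [IsProbabilityMeasure P]
    (hg2 : ∀ m i, MemLp (fun ω => g m ω i) 2 P)
    (hgH : ∀ m m', MemLp (fun ω => combine (g m ω) (fun i => H ω i m')) 2 P) (m : Fin Nt) :
    ∑ k, ρfl / Nt * ∫ ω, ‖gainError P H g m k ω‖ ^ 2 ∂P
        + ∑ i, σ2 * ∫ ω, ‖g m ω i‖ ^ 2 ∂P
      = (∑ m' : Fin Nt, ρfl / Nt * powerGain P H g m m')
        - ρfl / Nt * ‖meanGain P H g m m‖ ^ 2 + σ2 * ∫ ω, ∑ i, ‖g m ω i‖ ^ 2 ∂P := by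
  have h1 : ∀ k, ∫ ω, ‖gainError P H g m k ω‖ ^ 2 ∂P
      = powerGain P H g m k - if k = m then ‖meanGain P H g m m‖ ^ 2 else 0 := by
    intro k
    by_cases h : k = m
    · subst h
      simp only [gainError, if_true]
      exact integral_norm_sub_integral_sq (hgH k k)
    · simp [gainError, h, powerGain]
  rw [integral_finsetSum _ fun i _ => integrable_norm_sq (hg2 m i), Finset.mul_sum]
  simp_rw [h1, mul_sub, Finset.sum_sub_distrib]
  simp

/-- The denominator is a sum of powers by `sum_gainError_add_noise`. Were its noise part zero, the
combiner would vanish almost surely, and with it the mean gain. -/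
lemma sinrFL_pos [IsProbabilityMeasure P] (hρfl : 0 < ρfl) (hσ2 : 0 < σ2)
    (hg2 : ∀ m i, MemLp (fun ω => g m ω i) 2 P)
    (hgH : ∀ m m', MemLp (fun ω => combine (g m ω) (fun i => H ω i m')) 2 P)
    (hgain : ∀ m, meanGain P H g m m ≠ 0) (m : Fin Nt) :
    0 < sinrFL P ρfl σ2 H g m := by
  have hN : 0 < (Nt : ℝ) := Nat.cast_pos.2 m.pos
  have hc : 0 < ‖meanGain P H g m m‖ := norm_pos_iff.2 (hgain m)
  unfold sinrFL
  refine div_pos (by positivity) ?_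
  rw [← sum_gainError_add_noise hg2 hgH m]
  refine add_pos_of_nonneg_of_pos (Finset.sum_nonneg fun k _ => by positivity) ?_
  by_contra hcon
  have hnn : ∀ i, 0 ≤ σ2 * ∫ ω, ‖g m ω i‖ ^ 2 ∂P := fun i =>
    mul_nonneg hσ2.le (integral_nonneg fun ω => by positivity)
  have h0 := (Finset.sum_eq_zero_iff_of_nonneg fun i _ => hnn i).1
    (le_antisymm (not_lt.1 hcon) (Finset.sum_nonneg fun i _ => hnn i))
  have hzero : ∀ i, ∀ᵐ ω ∂P, g m ω i = 0 := by
    intro i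
    have h1 := (mul_eq_zero.1 (h0 i (Finset.mem_univ i))).resolve_left hσ2.ne'
    rw [integral_eq_zero_iff_of_nonneg (fun ω => by positivity)
      (integrable_norm_sq (hg2 m i))] at h1
    filter_upwards [h1] with ω hω
    simpa using hω
  refine hgain m (integral_eq_zero_of_ae ?_)
  filter_upwards [ae_all_iff.2 hzero] with ω hω
  simp [combine, dotProduct, hω]

/-- The combiner output after cancellation of the mobile layer, with the useful part removed. -/
lemma combine_cancelML_sub (ρml : ℝ) (xml : Fin Nt → ℂ) (s : ℂ) (a : Fin Nt) (n : Fin Nr → ℂ)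
    (m : Fin Nt) (ω : Ω) :
    combine (g m ω) (cancelML (H ω) ρml xml
        (received (H ω) (transmitted ρml ρfl xml (smSymbol s a)) n))
      - (√ρfl : ℂ) * meanGain P H g m m * smSymbol s a m
    = ∑ l : Fin Nt ⊕ Fin Nr, Sum.elim (fun k => (√ρfl : ℂ) * smSymbol s a k) n l
        * Sum.elim (fun k => gainError P H g m k ω) (fun i => star (g m ω i)) l := by
  have h1 : cancelML (H ω) ρml xml (received (H ω) (transmitted ρml ρfl xml (smSymbol s a)) n)
      = (√ρfl : ℂ) • (H ω *ᵥ smSymbol s a) + n := by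
    unfold cancelML received transmitted
    rw [Matrix.mulVec_add, Matrix.mulVec_smul, Matrix.mulVec_smul]
    abel
  have h2 : star (g m ω) ⬝ᵥ (H ω *ᵥ smSymbol s a)
      = ∑ k, smSymbol s a k * combine (g m ω) (fun i => H ω i k) := by
    rw [Matrix.dotProduct_mulVec]
    simp only [dotProduct, combine, Matrix.vecMul]
    exact Finset.sum_congr rfl fun k _ => mul_comm _ _
  rw [h1, combine, dotProduct_add, dotProduct_smul, h2, Fintype.sum_sum_type]
  simp only [Sum.elim_inl, Sum.elim_inr, gainError, mul_sub, Finset.sum_sub_distrib, mul_ite,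
    mul_zero, Finset.sum_ite_eq', Finset.mem_univ, if_true, smul_eq_mul, Finset.mul_sum,
    dotProduct, Pi.star_apply]
  have h3 : ∑ i, star (g m ω i) * n i = ∑ i, n i * star (g m ω i) :=
    Finset.sum_congr rfl fun i _ => mul_comm _ _
  have h4 : ∑ k, (√ρfl : ℂ) * (smSymbol s a k * combine (g m ω) (fun i => H ω i k))
      = ∑ k, (√ρfl : ℂ) * smSymbol s a k * combine (g m ω) (fun i => H ω i k) :=
    Finset.sum_congr rfl fun k _ => (mul_assoc _ _ _).symm
  rw [h3, h4]
  ring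

/-- The SINR is the ratio of useful power to interference-plus-noise power. -/
lemma powerRatio_eq_sinrFL [IsProbabilityMeasure P] (ρml : ℝ) (hρfl : 0 < ρfl) (hσ2 : 0 < σ2)
    (hg2 : ∀ m i, MemLp (fun ω => g m ω i) 2 P)
    (hgH : ∀ m m', MemLp (fun ω => combine (g m ω) (fun i => H ω i m')) 2 P)
    (xml : Ω → Fin Nt → ℂ)
    {s : Ω → ℂ} (hs : HasLaw s (complexGaussian 1) P)
    {a : Ω → Fin Nt} (ha : Measurable a) (ha_unif : ∀ m, P (a ⁻¹' {m}) = (Nt : ℝ≥0∞)⁻¹)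
    {n : Ω → Fin Nr → ℂ} (hn : IsDiagComplexGaussian P (fun i ω => n ω i) (fun _ => σ2))
    (hind₁ : IndepFun (fun ω => (fun i j => H ω i j, fun m => g m ω))
      (fun ω => (s ω, a ω, n ω)) P)
    (hind₂ : IndepFun s (fun ω => (a ω, n ω)) P) (m : Fin Nt) :
    powerRatio P
        (fun ω => combine (g m ω) (cancelML (H ω) ρml (xml ω)
          (received (H ω) (transmitted ρml ρfl (xml ω) (smSymbol (s ω) (a ω))) (n ω))))
        (fun ω => (√ρfl : ℂ) * meanGain P H g m m * smSymbol (s ω) (a ω) m)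
      = sinrFL P ρfl σ2 H g m := by
  have hsa : IndepFun s a P := hind₂.comp measurable_id measurable_fst
  have hsqrt : ‖(√ρfl : ℂ)‖ ^ 2 = ρfl := by
    rw [Complex.norm_real, Real.norm_eq_abs, sq_abs, Real.sq_sqrt hρfl.le]
  have hn2 : ∀ i, MemLp (fun ω => n ω i) 2 P := fun i =>
    memLp_of_hasLaw_complexGaussian (hn.1 i)
  have hs2 : MemLp s 2 P := memLp_of_hasLaw_complexGaussian hs
  have hs0 : ∫ ω, s ω ∂P = 0 := hs.integral_eq.trans (integral_id_complexGaussian _)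
  have hn0 : ∀ i, ∫ ω, n ω i ∂P = 0 := fun i =>
    (hn.1 i).integral_eq.trans (integral_id_complexGaussian _)
  -- The signals `U` are the antenna symbols and the noise components; the coefficients `V` depend
  -- on channel and combiners only.
  let U : Fin Nt ⊕ Fin Nr → Ω → ℂ := fun l ω =>
    Sum.elim (fun k => (√ρfl : ℂ) * smSymbol (s ω) (a ω) k) (n ω) l
  let V : Fin Nt ⊕ Fin Nr → Ω → ℂ := fun l ω =>
    Sum.elim (fun k => gainError P H g m k ω) (fun i => star (g m ω i)) l
  have hU : ∀ l, MemLp (U l) 2 P := by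
    rintro (k | i)
    · exact (memLp_smSymbol hs ha k).const_mul _
    · exact hn2 i
  have hV : ∀ l, MemLp (V l) 2 P := by
    rintro (k | i)
    · exact memLp_gainError hgH m k
    · exact (hg2 m i).star
  have hUV : IndepFun (fun ω l => V l ω) (fun ω l => U l ω) P := by
    refine hind₁.comp
      (φ := fun p : (Fin Nr → Fin Nt → ℂ) × (Fin Nt → Fin Nr → ℂ) => fun l =>
        Sum.elim (fun k => combine (p.2 m) (fun i => p.1 i k)
          - if k = m then meanGain P H g m m else 0) (fun i => star (p.2 m i)) l)
      (ψ := fun q : ℂ × Fin Nt × (Fin Nr → ℂ) => fun l : Fin Nt ⊕ Fin Nr =>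
        Sum.elim (fun k => (√ρfl : ℂ) * smSymbol q.1 q.2.1 k) q.2.2 l) ?_ ?_
    · refine measurable_pi_lambda _ ?_
      rintro (k | i)
      · simp only [Sum.elim_inl, combine, dotProduct, Pi.star_apply]
        fun_prop
      · simp only [Sum.elim_inr]
        fun_prop
    · refine measurable_pi_lambda _ ?_
      rintro (k | i)
      · simp only [Sum.elim_inl]
        have h : Measurable fun q : ℂ × Fin Nt × (Fin Nr → ℂ) => smSymbol q.1 q.2.1 :=
          measurable_smSymbol.comp (f := fun q : ℂ × Fin Nt × (Fin Nr → ℂ) => (q.1, q.2.1))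
            (by fun_prop)
        exact (measurable_pi_iff.1 h k).const_mul _
      · simp only [Sum.elim_inr]
        fun_prop
  -- The symbol `s` factors out, is centred, and is independent of the pair of active antenna and
  -- noise.
  have hxn : ∀ k i, ∫ ω, smSymbol (s ω) (a ω) k * star (n ω i) ∂P = 0 := by
    intro k i
    have hI : IndepFun s (fun ω => smSymbol 1 (a ω) k * star (n ω i)) P := by
      refine hind₂.comp (φ := id)
        (ψ := fun q : Fin Nt × (Fin Nr → ℂ) => smSymbol 1 q.1 k * star (q.2 i))
        measurable_id ?_
      have h1 : Measurable fun b : Fin Nt => smSymbol (1 : ℂ) b k := measurable_of_finite _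
      fun_prop
    have h1 : Measurable fun b : Fin Nt => smSymbol (1 : ℂ) b k := measurable_of_finite _
    have h2 : ∀ ω, smSymbol (s ω) (a ω) k * star (n ω i)
        = s ω * (smSymbol 1 (a ω) k * star (n ω i)) := fun ω => by
      unfold smSymbol
      by_cases h : k = a ω
      · subst h; simp
      · simp [Pi.single_eq_of_ne h]
    simp_rw [h2]
    rw [hI.integral_fun_mul_eq_mul_integral hs2.1
      ((h1.comp ha).aestronglyMeasurable.mul (hn2 i).star.1), hs0, zero_mul]
  have horth : ∀ l l', l ≠ l' → ∫ ω, U l ω * star (U l' ω) ∂P = 0 := by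
    rintro (k | i) (k' | i') hll
    · have hk : k ≠ k' := fun h => hll (by rw [h])
      -- Two different antennas are never active together, so the product vanishes pointwise.
      have h0 : ∀ ω, U (.inl k) ω * star (U (.inl k') ω) = 0 := fun ω => by
        simp only [U, Sum.elim_inl, smSymbol]
        by_cases h : k = a ω
        · have : k' ≠ a ω := fun h' => hk (h.trans h'.symm)
          simp [Pi.single_eq_of_ne this]
        · simp [Pi.single_eq_of_ne h]
      simp only [h0, integral_zero]
    · simp only [U, Sum.elim_inl, Sum.elim_inr, mul_assoc]
      rw [integral_const_mul, hxn, mul_zero]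
    · have h0 : ∀ ω, U (.inr i) ω * star (U (.inl k') ω)
          = star ((√ρfl : ℂ) * (smSymbol (s ω) (a ω) k' * star (n ω i))) := fun ω => by
        simp only [U, Sum.elim_inl, Sum.elim_inr, star_mul', star_star]
        ring
      simp_rw [h0]
      rw [integral_star, integral_const_mul, hxn, mul_zero, star_zero]
    · have hi : i ≠ i' := fun h => hll (by rw [h])
      have hI : IndepFun (fun ω => n ω i) (fun ω => star (n ω i')) P :=
        (hn.2.indepFun hi).comp (ψ := fun z : ℂ => star z) measurable_id (by fun_prop)
      change ∫ ω, n ω i * star (n ω i') ∂P = 0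
      rw [hI.integral_fun_mul_eq_mul_integral (hn2 i).1 (hn2 i').star.1, hn0, zero_mul]
  have hden := integral_norm_sq_sum_mul hU hV hUV horth
  unfold powerRatio
  simp_rw [combine_cancelML_sub]
  rw [sinrFL, ← sum_gainError_add_noise hg2 hgH m]
  congr 1
  · have h : ∀ ω, ‖(√ρfl : ℂ) * meanGain P H g m m * smSymbol (s ω) (a ω) m‖ ^ 2
        = ρfl * ‖meanGain P H g m m‖ ^ 2 * ‖smSymbol (s ω) (a ω) m‖ ^ 2 := fun ω => by
      rw [norm_mul, norm_mul, mul_pow, mul_pow, hsqrt]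
    simp_rw [h]
    rw [integral_const_mul, integral_norm_sq_smSymbol hs ha ha_unif hsa]
    ring
  · refine hden.trans ?_
    rw [Fintype.sum_sum_type]
    congr 1
    · refine Finset.sum_congr rfl fun k _ => ?_
      simp only [U, V, Sum.elim_inl, norm_mul, mul_pow, hsqrt]
      rw [integral_const_mul, integral_norm_sq_smSymbol hs ha ha_unif hsa, div_eq_mul_inv]
    · refine Finset.sum_congr rfl fun i _ => ?_
      simp only [U, V, Sum.elim_inr, norm_star]
      rw [integral_norm_sq_of_hasLaw (hn.1 i), Real.coe_toNNReal _ hσ2.le]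

end Sinr

end

/-! ### The determinants of the bound as overlaps, and the conversion to nats. -/

lemma sigmaFL_eq_diagonal {N : ℕ} (S : Fin N → ℝ) (m : Fin N) :
    sigmaFL S m = Matrix.diagonal fun i => 1 / S i + N * (Pi.single m 1 : Fin N → ℝ) i := by
  rw [sigmaFL, ← Matrix.diagonal_smul, Matrix.diagonal_add]
  rfl

/-- The matrices are diagonal, so the quotient is a product over coordinates. Each coordinate gives
a factor 1/2, and a further factor other than 1 arises only at m and m', when these differ. -/
lemma det_sigmaFL_div {N : ℕ} {S : Fin N → ℝ} (hS : ∀ i, 0 < S i) (m m' : Fin N) :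
    (sigmaFL S m).det / (sigmaFL S m + sigmaFL S m').det
      = (2⁻¹ : ℝ) ^ N * overlap (fun i => N * S i) m m' := by
  have hN : 0 < (N : ℝ) := Nat.cast_pos.2 m.pos
  rw [sigmaFL_eq_diagonal, sigmaFL_eq_diagonal, Matrix.diagonal_add, Matrix.det_diagonal,
    Matrix.det_diagonal, ← Finset.prod_div_distrib]
  have h : ∀ i, (1 / S i + N * (Pi.single m 1 : Fin N → ℝ) i)
      / (1 / S i + N * (Pi.single m 1 : Fin N → ℝ) i
        + (1 / S i + N * (Pi.single m' 1 : Fin N → ℝ) i))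
      = 2⁻¹ * ((1 + N * S i * (Pi.single m 1 : Fin N → ℝ) i)
        / (1 + N * S i / 2 * ((Pi.single m 1 : Fin N → ℝ) i + (Pi.single m' 1 : Fin N → ℝ) i))) := by
    intro i
    have hSi := hS i
    have h1 : 0 ≤ (Pi.single m 1 : Fin N → ℝ) i := by
      by_cases h : i = m
      · subst h; simp
      · simp [Pi.single_eq_of_ne h]
    have h2 : 0 ≤ (Pi.single m' 1 : Fin N → ℝ) i := by
      by_cases h : i = m'
      · subst h; simp
      · simp [Pi.single_eq_of_ne h]
    generalize (Pi.single m 1 : Fin N → ℝ) i = x at h1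
    generalize (Pi.single m' 1 : Fin N → ℝ) i = y at h2
    rw [div_eq_iff (by positivity)]
    field_simp
    ring
  simp_rw [h]
  rw [Finset.prod_mul_distrib, Finset.prod_const, Finset.card_univ, Fintype.card_fin]
  congr 1
  unfold overlap
  split_ifs with hm
  · subst hm
    refine Finset.prod_eq_one fun i _ => ?_
    by_cases h : i = m
    · subst h
      have := hS i
      simp only [Pi.single_eq_same]
      rw [div_eq_one_iff_eq (by positivity)]; ring
    · simp [Pi.single_eq_of_ne h]
  · rw [Finset.prod_eq_mul m m' hm]
    · have := hS m
      have := hS m'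
      simp only [Pi.single_eq_same, Pi.single_eq_of_ne hm, Pi.single_eq_of_ne (Ne.symm hm)]
      field_simp
      ring
    · intro i _ hi
      simp [Pi.single_eq_of_ne hi.1, Pi.single_eq_of_ne hi.2]
    · simp
    · simp

/-- The lower bound on the spectral efficiency, in nats. -/
lemma seBoundFL_mul_log_two {N : ℕ} [NeZero N] {S : Fin N → ℝ} (hS : ∀ i, 0 < S i) :
    seBoundFL S * Real.log 2 = (N : ℝ)⁻¹ * ∑ m, N * S m
      - (N : ℝ)⁻¹ * ∑ m, (N * S m - Real.log (1 + N * S m)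
        + Real.log ((N : ℝ)⁻¹ * ∑ m', overlap (fun i => N * S i) m m')) := by
  have hN : 0 < (N : ℝ) := Nat.cast_pos.2 (NeZero.pos N)
  have hl : Real.log 2 ≠ 0 := (Real.log_pos one_lt_two).ne'
  have ho : ∀ m, 0 < ∑ m', overlap (fun i => N * S i) m m' := fun m =>
    Finset.sum_pos (fun m' _ => overlap_pos (fun i => mul_pos hN (hS i)) m m')
      Finset.univ_nonempty
  have h1 : ∀ m, Real.logb 2 (∑ m', (sigmaFL S m).det / (sigmaFL S m + sigmaFL S m').det)
      = Real.log (∑ m', overlap (fun i => N * S i) m m') / Real.log 2 - N := fun m => by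
    simp_rw [det_sigmaFL_div hS]
    rw [← Finset.mul_sum, Real.logb, Real.log_mul (by positivity) (ho m).ne', Real.log_pow,
      Real.log_inv]
    field_simp
    ring
  have h2 : ∀ m, Real.log ((N : ℝ)⁻¹ * ∑ m', overlap (fun i => N * S i) m m')
      = Real.log (∑ m', overlap (fun i => N * S i) m m') - Real.log N := fun m => by
    rw [Real.log_mul (by positivity) (ho m).ne', Real.log_inv]
    ring
  unfold seBoundFL
  simp_rw [h1, h2, Real.logb, Finset.sum_add_distrib, Finset.sum_sub_distrib, ← Finset.sum_div]
  simp only [Finset.sum_const, Finset.card_univ, Fintype.card_fin, nsmul_eq_mul]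
  field_simp
  ring

end SMLDM

theorem theorem2 {Ω : Type*} [MeasurableSpace Ω] (P : Measure Ω) [IsProbabilityMeasure P]
    {Nt Nr : ℕ}
    -- powers of the two layers and noise variance at the fixed receiver
    (ρml ρfl σ2 : ℝ) (hρfl : 0 < ρfl) (hσ2 : 0 < σ2)
    -- Rayleigh fading channel with i.i.d. `CN(0,1)` entries
    (H : Ω → Matrix (Fin Nr) (Fin Nt) ℂ)
    (hH : SMLDM.IsDiagComplexGaussian P (fun (p : Fin Nr × Fin Nt) ω => H ω p.1 p.2)
      (fun _ => 1))
    -- random combining vectors, one for each antenna, such that the expectations in the SINR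
    -- exist and the useful gain does not vanish
    (g : Fin Nt → Ω → Fin Nr → ℂ) (hg : ∀ m, Measurable (g m))
    (hg2 : ∀ m i, MemLp (fun ω => g m ω i) 2 P)
    (hgH : ∀ m m', MemLp (fun ω => SMLDM.combine (g m ω) (fun i => H ω i m')) 2 P)
    (hgain : ∀ m, SMLDM.meanGain P H g m m ≠ 0)
    -- arbitrary mobile-layer symbol and active antenna
    (sml : Ω → ℂ) (aml : Ω → Fin Nt)
    -- fixed layer: Gaussian symbol, uniformly distributed active antenna
    (s : Ω → ℂ) (hs : HasLaw s (SMLDM.complexGaussian 1) P)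
    (a : Ω → Fin Nt) (ha : Measurable a) (ha_unif : ∀ m, P (a ⁻¹' {m}) = (Nt : ℝ≥0∞)⁻¹)
    -- white Gaussian noise at the fixed receiver
    (n : Ω → Fin Nr → ℂ) (hn : SMLDM.IsDiagComplexGaussian P (fun i ω => n ω i) (fun _ => σ2))
    -- channel and combiners, symbol, active antenna, and noise are mutually independent
    (hind₁ : IndepFun (fun ω => (fun i j => H ω i j, fun m => g m ω))
      (fun ω => (s ω, a ω, n ω)) P)
    (hind₂ : IndepFun s (fun ω => (a ω, n ω)) P)
    (hind₃ : IndepFun a n P)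
    -- noise of the equivalent channel: Gaussian with covariance `diag(1 / SINRₘ)`, independent
    -- of the fixed-layer input
    (w : Ω → Fin Nt → ℂ)
    (hw : SMLDM.IsDiagComplexGaussian P (fun m ω => w ω m)
      (fun m => 1 / SMLDM.sinrFL P ρfl σ2 H g m))
    (hw_ind : IndepFun w (fun ω => (s ω, a ω)) P) :
    -- the SINR is positive, and it is the ratio of the useful power to the interference-plus-noise
    -- power at the `m`-th combiner output after cancellation of the mobile layer
    (∀ m, 0 < SMLDM.sinrFL P ρfl σ2 H g m ∧
      SMLDM.powerRatio P
        (fun ω => SMLDM.combine (g m ω)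
          (SMLDM.cancelML (H ω) ρml (SMLDM.smSymbol (sml ω) (aml ω))
            (SMLDM.received (H ω)
              (SMLDM.transmitted ρml ρfl (SMLDM.smSymbol (sml ω) (aml ω))
                (SMLDM.smSymbol (s ω) (a ω)))
              (n ω))))
        (fun ω => (√ρfl : ℂ) * SMLDM.meanGain P H g m m * SMLDM.smSymbol (s ω) (a ω) m)
      = SMLDM.sinrFL P ρfl σ2 H g m) ∧
    -- the spectral efficiency, which is the mutual information in bits between the input `x` and
    -- the output `√Nt x + w` of the equivalent channel, is finite and is bounded below
    SMLDM.mutualInfo P (fun ω => (√(Nt : ℝ) : ℂ) • SMLDM.smSymbol (s ω) (a ω) + w ω)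
      (fun ω => SMLDM.smSymbol (s ω) (a ω)) ≠ ∞ ∧
    SMLDM.seBoundFL (SMLDM.sinrFL P ρfl σ2 H g) ≤
      (SMLDM.mutualInfo P (fun ω => (√(Nt : ℝ) : ℂ) • SMLDM.smSymbol (s ω) (a ω) + w ω)
        (fun ω => SMLDM.smSymbol (s ω) (a ω))).toReal / Real.log 2 := by
  -- A probability space is nonempty, and any value of `a` witnesses an antenna.
  have : NeZero Nt := by
    obtain ⟨ω⟩ := P.nonempty_of_neZero
    exact ⟨(a ω).pos.ne'⟩
  have hN : 0 < (Nt : ℝ) := Nat.cast_pos.2 (NeZero.pos Nt)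
  set S := SMLDM.sinrFL P ρfl σ2 H g with hSdef
  have hS : ∀ m, 0 < S m := SMLDM.sinrFL_pos hρfl hσ2 hg2 hgH hgain
  have hv : ∀ m, 0 < 1 / S m := fun m => one_div_pos.2 (hS m)
  have hsa : IndepFun s a P := hind₂.comp measurable_id measurable_fst
  have hwlaw : HasLaw w (SMLDM.diagGaussian fun m => 1 / S m) P := hw.2.hasLaw_pi hw.1
  obtain ⟨hfin, hint, hval⟩ := SMLDM.mutualInfo_channel hv hs ha ha_unif hsa hwlaw hw_ind
    (Real.sqrt_pos.2 hN).ne'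
  -- The channel gain √Nt and the noise variance 1 / S_m produce the parameter t_m = Nt S_m.
  have ht : ∀ m, √(Nt : ℝ) ^ 2 / (1 / S m) = Nt * S m := fun m => by
    rw [Real.sq_sqrt hN.le, div_div_eq_mul_div, div_one]
  simp_rw [ht] at hint hval
  refine ⟨fun m => ⟨hS m, SMLDM.powerRatio_eq_sinrFL ρml hρfl hσ2 hg2 hgH
    (fun ω => SMLDM.smSymbol (sml ω) (aml ω)) hs ha ha_unif hn hind₁ hind₂ m⟩, hfin, ?_⟩
  rw [le_div_iff₀ (Real.log_pos one_lt_two), SMLDM.seBoundFL_mul_log_two hS, hval]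
  exact sub_le_sub_left
    (SMLDM.integral_mixRatio_mul_log_le hv (fun i => mul_pos hN (hS i)) hint) _
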